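/- **Normal cycles.** Write $T\mathbb R^3=E\times F$ with $E=F=\mathbb R^3$ and the inner product $\langle (x,y),(x',y')\rangle=\langle x,x'\rangle+\langle y,y'\rangle$. For a compact convex set $\mathcal C\subset\mathbb R^3$, the normal cycle $N(\mathcal C)$ is the $2$-current $\varphi\mapsto\int_{S(\mathcal C)}\langle \vec S,\varphi\rangle\,d\mathcal H^2$ associated with the unit normal bundle $$S(\mathcal C)=\{(p,n):\ p\in\partial\mathcal C,\ \|n\|=1,\ n\cdot(x-p)\le 0\ \text{ for all } x\in\mathcal C\}\subset E\times F,$$ where $\vec S$ is the unit simple $2$-vector of the tangent plane of $S(\mathcal C)$, oriented so that a basis $(x_1,y_1),(x_2,y_2)$ of the tangent plane at $(p,n)$ is positive when $\det(x_1+y_1,x_2+y_2,n)>0$ (orientation by the outer normal). The normal cycle of a finite union of compact convex sets is defined by inclusion-exclusion; for two sets, $N(\mathcal C_1\cup\mathcal C_2)=N(\mathcal C_1)+N(\mathcal C_2)-N(\mathcal C_1\cap\mathcal C_2)$. **Curvature measures.** At $(m,\xi)$ with $\|\xi\|=1$, choose $(e_1,e_2)$ such that $(e_1,e_2,\xi)$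 is a direct orthonormal basis of $\mathbb R^3$, and let $e_i^*(x,y)=\langle e_i,x\rangle$ and $\epsilon_i^*(x,y)=\langle e_i,y\rangle$. Let $\omega_k$ be the coefficient of $t^k$ in the $2$-form $(e_1^*+t\epsilon_1^*)\wedge(e_2^*+t\epsilon_2^*)$; it does not depend on the choice of $(e_1,e_2)$. For a Borel set $B$ put $\Phi^k_{\mathcal C}(B)=N(\mathcal C)(\mathbf 1_{B\times F}\,\omega_k)$. The mean and Gaussian curvature measures are $\Phi^H=\Phi^1$ and $\Phi^G=\Phi^2$. **Proposition.** Let $r>0$, and let $\mathbb B_1,\mathbb B_2\subset\mathbb R^3$ be the closed balls of radius $r$ with centres $A_1,A_2$, where $0<A_1A_2<2r$, so that $C=\partial\mathbb B_1\cap\partial\mathbb B_2$ is a circle. Let $B\subset\mathbb R^3$ be a Borel set (for instance a ball), and let $$\beta=2\pi\,\frac{\mathrm{length}(B\cap C)}{\mathrm{length}(C)},$$ which is the angle of the arc $B\cap C$ when $B$ is a ball. Then $$\Phi^H_{\mathbb B_1\cup\mathbb B_2}(B\cap C)=-2\beta r\,\arcsin\!\Big(\frac{A_1A_2}{2r}\Big)\sqrt{1-\Big(\frac{A_1A_2}{2r}\Big)^2}$$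 and $$\Phi^G_{\mathbb B_1\cup\mathbb B_2}(B\cap C)=-\frac{\beta\,A_1A_2}{r}.$$ -/

import Mathlib

open MeasureTheory
open scoped Polynomial

/-- The base space `ℝ³` with its Euclidean inner product. -/
abbrev E3 : Type := EuclideanSpace ℝ (Fin 3)

/-- The total space `E × F` of the tangent bundle of `ℝ³`, with the inner product
`⟨(e, f), (e', f')⟩ = ⟨e, e'⟩ + ⟨f, f'⟩`; the fibre `F` is identified with `ℝ³`. -/
abbrev TE3 : Type := WithLp 2 (E3 × E3)

/-- The determinant of three vectors of `ℝ³` in the standard basis. -/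
def det3 (a b c : E3) : ℝ :=
  Matrix.det !![a 0, a 1, a 2; b 0, b 1, b 2; c 0, c 1, c 2]

/-! ### Differential forms and currents -/

/-- A (not necessarily smooth) differential 2-form on `E × F`. -/
abbrev TwoForm : Type := TE3 → TE3 [⋀^Fin 2]→ₗ[ℝ] ℝ

/-- A current of dimension 2. All those below are finite combinations of currents representable
by integration, hence they act on forms with bounded Borel coefficients. -/
abbrev TwoCurrent : Type := TwoForm → ℝ

/-- The restriction `T ⌞ A`, which sends `φ` to `T (1_A φ)`. -/
noncomputable def TwoCurrent.restrict (T : TwoCurrent) (A : Set TE3) : TwoCurrent :=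
  fun φ => T (A.indicator φ)

/-- The current `φ ↦ ∫_S ⟨τ₀ ∧ τ₁, φ⟩ dℋ²` of a set `S` oriented by the 2-vector field
`τ₀ ∧ τ₁`. Here `μHE[2]` is the 2-dimensional Hausdorff measure, normalised so as to be the
Lebesgue measure on Euclidean planes. -/
noncomputable def currentOfOrientedSet (S : Set TE3) (τ : TE3 → Fin 2 → TE3) : TwoCurrent :=
  fun φ => ∫ p in S, φ p (τ p) ∂μHE[2]

/-! ### The normal cycle -/

/-- The unit normal bundle `S(C)` of a convex set `C`: the pairs `(p, n)` with `p ∈ ∂C` and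
`n` a unit vector of the normal cone of `C` at `p`. -/
def normalBundle (C : Set E3) : Set TE3 :=
  {p | p.fst ∈ frontier C ∧ ‖p.snd‖ = 1 ∧ ∀ x ∈ C, inner ℝ p.snd (x - p.fst) ≤ 0}

/-- `a` is a positive orthonormal basis of the tangent plane of `S` at `p = (m, ξ)`. The
orientation is the one that the map `(m, ξ) ↦ m + ξ` carries to the orientation by the outer
normal `ξ`: a basis `(x₀, y₀), (x₁, y₁)` of the tangent plane is positive when
`(x₀ + y₀, x₁ + y₁, ξ)` is a direct basis of `ℝ³`. -/
def IsPositiveTangentFrame (S : Set TE3) (p : TE3) (a : Fin 2 → TE3) : Prop :=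
  Orthonormal ℝ a ∧
  (Submodule.span ℝ (Set.range a) : Set TE3) = tangentConeAt ℝ S p ∧
  0 < det3 ((a 0).fst + (a 0).snd) ((a 1).fst + (a 1).snd) p.snd

open Classical in
/-- A positive orthonormal basis of the tangent plane of `S` at `p`, where this plane exists
(almost everywhere on the unit normal bundle of a compact convex set). The 2-vector that it
spans does not depend on the choice. -/
noncomputable def positiveTangentFrame (S : Set TE3) (p : TE3) : Fin 2 → TE3 :=
  if h : ∃ a, IsPositiveTangentFrame S p a then h.choose else 0

/-- The normal cycle of a compact convex set: the current of its oriented unit normal bundle. -/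
noncomputable def normalCycle (C : Set E3) : TwoCurrent :=
  currentOfOrientedSet (normalBundle C) (positiveTangentFrame (normalBundle C))

/-- The normal cycle of a finite union `⋃ i, C i` of compact convex sets, defined by
inclusion-exclusion:
`∑_{l ≥ 1} (-1)^(l + 1) ∑_{i₁ < ⋯ < i_l} N(C_{i₁} ∩ ⋯ ∩ C_{i_l})`. -/
noncomputable def unionNormalCycle {n : ℕ} (C : Fin n → Set E3) : TwoCurrent :=
  ∑ s ∈ Finset.univ.filter (fun s : Finset (Fin n) => s.Nonempty),
    (-1 : ℝ) ^ (s.card + 1) • normalCycle (⋂ i ∈ s, C i)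

/-! ### Invariant forms and curvature measures -/

/-- `(e 0, e 1)` is an orthonormal frame of the plane orthogonal to `ξ` and `(e 0, e 1, ξ)` is
direct. -/
def IsDirectFrame (ξ : E3) (e : Fin 2 → E3) : Prop :=
  Orthonormal ℝ e ∧ (∀ i, inner ℝ (e i) ξ = 0) ∧ 0 < det3 (e 0) (e 1) ξ

open Classical in
/-- A direct orthonormal frame of the plane orthogonal to the unit vector `ξ`. -/
noncomputable def directFrame (ξ : E3) : Fin 2 → E3 :=
  if h : ∃ e, IsDirectFrame ξ e then h.choose else 0

/-- The linear map `v ↦ (eⱼ* v + t εⱼ* v)ⱼ` with values in polynomials in `t`, where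
`eⱼ* (x, y) = ⟨eⱼ, x⟩` and `εⱼ* (x, y) = ⟨eⱼ, y⟩`. -/
noncomputable def frameForms (e : Fin 2 → E3) : TE3 →ₗ[ℝ] (Fin 2 → ℝ[X]) where
  toFun v j := Polynomial.C (inner ℝ (e j) v.fst) +
    Polynomial.X * Polynomial.C (inner ℝ (e j) v.snd)
  map_add' v w := by
    funext j
    simp only [WithLp.add_fst, WithLp.add_snd, inner_add_right, Pi.add_apply, map_add]
    ring
  map_smul' c v := by
    funext j
    simp only [WithLp.smul_fst, WithLp.smul_snd, inner_smul_right, Pi.smul_apply, map_mul,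
      RingHom.id_apply, Polynomial.smul_eq_C_mul]
    ring

/-- The 2 × 2 determinant of polynomials as an `ℝ`-bilinear alternating map. -/
noncomputable def polyDet : (Fin 2 → ℝ[X]) [⋀^Fin 2]→ₗ[ℝ] ℝ[X] :=
  { (Matrix.detRowAlternating (n := Fin 2) (R := ℝ[X])).toMultilinearMap.restrictScalars ℝ with
    map_eq_zero_of_eq' := fun v _ _ h hij =>
      (Matrix.detRowAlternating (n := Fin 2) (R := ℝ[X])).map_eq_zero_of_eq v h hij }

/-- The form `ω_k`: its value at `(m, ξ)` is the coefficient of `t ^ k` in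
`Ω = (e₀* + t ε₀*) ∧ (e₁* + t ε₁*)`, for a direct orthonormal frame `(e₀, e₁)` of the plane
orthogonal to `ξ`. -/
noncomputable def invariantForm (k : ℕ) : TwoForm := fun p =>
  (Polynomial.lcoeff ℝ k).compAlternatingMap
    (polyDet.compLinearMap (frameForms (directFrame p.snd)))

/-- The `k`-th curvature measure `Φ^k (B) = (N ⌞ (B × F)) (ω_k)` defined by a normal cycle `N`. -/
noncomputable def curvatureMeasure (N : TwoCurrent) (k : ℕ) (B : Set E3) : ℝ :=
  N.restrict {p | p.fst ∈ B} (invariantForm k)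

/-- The mean curvature measure `Φ^H = Φ^1` of the union of the compact convex sets `C i`. -/
noncomputable def meanCurvatureMeasure {n : ℕ} (C : Fin n → Set E3) (B : Set E3) : ℝ :=
  curvatureMeasure (unionNormalCycle C) 1 B

/-- The Gaussian curvature measure `Φ^G = Φ^2` of the union of the compact convex sets `C i`. -/
noncomputable def gaussCurvatureMeasure {n : ℕ} (C : Fin n → Set E3) (B : Set E3) : ℝ :=
  curvatureMeasure (unionNormalCycle C) 2 B

open Set Filter Topology
open scoped ENNReal NNReal

/-! ### Area formula from local bi-Lipschitz comparison -/

/-! Inclusion-exclusion gives Φ(𝔹₁) + Φ(𝔹₂) − Φ(𝔹₁ ∩ 𝔹₂). At each point of the circle a ball has a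
single unit normal, so over the circle the unit normal bundle of a ball is a curve, which is
`ℋ²`-null. Only minus the contribution of the lens 𝔹₁ ∩ 𝔹₂ remains.

Put `α = arcsin (A₁A₂ / 2r)`. The circle has radius `ρ = r cos α`, and at its point of longitude `θ`
the unit normals of the lens are the vectors `spherical b θ φ` with `φ ∈ [-α, α]`, an arc between
the two radial directions. The bundle over the circle is thus the piece `|φ| ≤ α` of a torus,
parametrized by `normalTorus`. With `a = angular b θ`, its partial derivatives are `(ρ a, cos φ a)`
and `(0, sphericalDeriv b θ φ)`; they are orthogonal, of norms `J = √(ρ² + cos² φ)` and `1`. On the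
positive unit 2-vector, `ω₁` takes the value `ρ / J` and `ω₂` the value `cos φ / J`
(`invariantForm_positiveTangentFrame`). The area element `J dθ dφ` cancels `J`. If `Θ` is the set of
longitudes of `B ∩ C`, then `|Θ| = β`, and the lens contributes `2αρβ` and `2β sin α`.

Three points need care. The area element of the torus is obtained by comparing `normalTorus` near
each point with a linear map, up to a bi-Lipschitz factor tending to `1`
(`euclideanHausdorffMeasure_image_eq_lintegral`). The frames in the definitions are arbitrary
choices, so the forms must be shown invariant under changes of frame of determinant `1`. The tangent
cone of the bundle must be exactly the plane of the partial derivatives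
(`tangentConeAt_normalBundle_lens`); this is proved for `|φ| < α`, and the two edges `φ = ±α` are
null. -/

theorem measure_image_eq_of_locally_comparable {P Y : Type*} [TopologicalSpace P] [PolishSpace P]
    [MeasurableSpace P] [BorelSpace P] [MetricSpace Y] [MeasurableSpace Y] [BorelSpace Y]
    {f : P → Y} {U : Set P} (hf : Continuous f) (hinj : InjOn f U)
    (μ : Measure P) (ν : Measure Y)
    (h : ∀ c : ℝ≥0, 1 < c → ∀ x, ∃ V ∈ 𝓝 x, ∀ A ⊆ V, MeasurableSet A →
      ν (f '' A) ≤ c * μ A ∧ μ A ≤ c * ν (f '' A)) :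
    ∀ A ⊆ U, MeasurableSet A → ν (f '' A) = μ A := by
  intro A hAU hA
  -- For fixed `c`, countably many of the given neighbourhoods cover `P`; cutting `A` into disjoint
  -- Borel pieces, one in each, globalizes the estimate with the same `c`. Letting `c → 1` then
  -- gives equality.
  have key : ∀ c : ℝ≥0, 1 < c → ν (f '' A) ≤ c * μ A ∧ μ A ≤ c * ν (f '' A) := by
    intro c hc
    choose V hV hVA using h c hc
    obtain ⟨s, hs, hcov⟩ := TopologicalSpace.countable_cover_nhds
      (f := fun x => interior (V x)) (fun x => interior_mem_nhds.2 (hV x))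
    have hne : A = ∅ ∨ s.Nonempty := by
      rcases s.eq_empty_or_nonempty with rfl | h
      · left
        simp only [mem_empty_iff_false, iUnion_of_empty, iUnion_empty] at hcov
        rw [eq_empty_iff_forall_notMem]
        intro x
        have : x ∈ (∅ : Set P) := hcov ▸ mem_univ x
        simp at this
      · exact Or.inr h
    rcases hne with rfl | hne
    · simp
    obtain ⟨g, rfl⟩ := hs.exists_eq_range hne
    set D : ℕ → Set P := fun n => A ∩ disjointed (fun n => interior (V (g n))) n with hD
    have hDm : ∀ n, MeasurableSet (D n) := fun n =>
      hA.inter (MeasurableSet.disjointed (fun n => isOpen_interior.measurableSet) n)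
    have hDU : ⋃ n, D n = A := by
      rw [hD, ← inter_iUnion, iUnion_disjointed]
      rw [biUnion_range] at hcov
      rw [hcov, inter_univ]
    have hDd : Pairwise (Function.onFun Disjoint D) := fun i j hij =>
      ((disjoint_disjointed (fun n => interior (V (g n)))) hij).mono inter_subset_right
        inter_subset_right
    have hDV : ∀ n, D n ⊆ V (g n) := fun n =>
      inter_subset_right.trans ((disjointed_subset _ _).trans interior_subset)
    have hDA : ∀ n, D n ⊆ A := fun n => inter_subset_left
    have h1 : μ A = ∑' n, μ (D n) := by
      conv_lhs => rw [← hDU]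
      exact measure_iUnion hDd hDm
    have h2 : ν (f '' A) = ∑' n, ν (f '' D n) := by
      conv_lhs => rw [← hDU, image_iUnion]
      refine measure_iUnion (fun i j hij => ?_) (fun n => ?_)
      · refine disjoint_image_image fun a ha b hb hab => ?_
        have e := hinj (hAU (hDA i ha)) (hAU (hDA j hb)) hab
        exact disjoint_left.1 (hDd hij) ha (e ▸ hb)
      -- Lusin–Souslin: an injective continuous image of a Borel set is Borel, so `ν` is additive
      -- over the images.
      · exact (hDm n).image_of_continuousOn_injOn hf.continuousOn
          (hinj.mono ((hDA n).trans hAU))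
    rw [h1, h2, ← ENNReal.tsum_mul_left, ← ENNReal.tsum_mul_left]
    exact ⟨ENNReal.tsum_le_tsum fun n => (hVA _ _ (hDV n) (hDm n)).1,
      ENNReal.tsum_le_tsum fun n => (hVA _ _ (hDV n) (hDm n)).2⟩
  have lim : ∀ a b : ℝ≥0∞, (∀ c : ℝ≥0, 1 < c → a ≤ c * b) → a ≤ b := by
    intro a b hab
    have ht : Tendsto (fun c : ℝ≥0 => (c : ℝ≥0∞) * b) (𝓝[>] 1) (𝓝 (((1 : ℝ≥0) : ℝ≥0∞) * b)) := by
      refine ENNReal.Tendsto.mul_const ?_ (Or.inl (by simp))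
      exact (ENNReal.continuous_coe.tendsto 1).mono_left nhdsWithin_le_nhds
    simp only [ENNReal.coe_one, one_mul] at ht
    exact ge_of_tendsto ht (eventually_nhdsWithin_of_forall fun c hc => hab c hc)
  exact le_antisymm (lim _ _ fun c hc => (key c hc).1) (lim _ _ fun c hc => (key c hc).2)

/-- On `A` the map `f` factors as a `c`-Lipschitz map after `g`. No injectivity of `g` is needed: by
the hypothesis, points with the same image under `g` have the same image under `f`. -/
theorem euclideanHausdorffMeasure_image_le_of_dist_le {P Y Z : Type*}
    [MetricSpace Y] [MeasurableSpace Y] [BorelSpace Y]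
    [MetricSpace Z] [MeasurableSpace Z] [BorelSpace Z] (d : ℕ)
    {f : P → Y} {g : P → Z} {A : Set P} {c : ℝ≥0}
    (h : ∀ a ∈ A, ∀ b ∈ A, dist (f a) (f b) ≤ c * dist (g a) (g b)) :
    μHE[d] (f '' A) ≤ (c : ℝ≥0∞) ^ d * μHE[d] (g '' A) := by
  rcases A.eq_empty_or_nonempty with rfl | ⟨a₀, ha₀⟩
  · simp
  have : Nonempty P := ⟨a₀⟩
  set k := Function.invFunOn g A
  have hk : ∀ a ∈ A, f (k (g a)) = f a := by
    intro a ha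
    have h1 : k (g a) ∈ A := Function.invFunOn_mem ⟨a, ha, rfl⟩
    have h2 : g (k (g a)) = g a := Function.invFunOn_eq ⟨a, ha, rfl⟩
    have := h _ h1 _ ha
    rw [h2, dist_self, mul_zero] at this
    exact dist_le_zero.1 this
  have hL : LipschitzOnWith c (f ∘ k) (g '' A) := by
    refine LipschitzOnWith.of_dist_le_mul ?_
    rintro _ ⟨a, ha, rfl⟩ _ ⟨b, hb, rfl⟩
    simp only [Function.comp_apply]
    rw [hk a ha, hk b hb]
    exact h a ha b hb
  have him : (f ∘ k) '' (g '' A) = f '' A := by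
    rw [image_image]
    exact image_congr hk
  have := hL.hausdorffMeasure_image_le (d := d) (by positivity)
  rw [him, ENNReal.rpow_natCast] at this
  simp only [Measure.euclideanHausdorffMeasure_def, Measure.smul_apply]
  simp only [ENNReal.smul_def, smul_eq_mul]
  rw [mul_left_comm]
  gcongr

/-- The linear comparison map `(x, y) ↦ (j x, y)` into the Euclidean plane. -/
def stretch (j : ℝ) (x : ℝ × ℝ) : WithLp 2 (ℝ × ℝ) := WithLp.toLp 2 (j * x.1, x.2)

theorem dist_stretch (j : ℝ) (a b : ℝ × ℝ) :
    dist (stretch j a) (stretch j b) = √(j ^ 2 * (a.1 - b.1) ^ 2 + (a.2 - b.2) ^ 2) := by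
  rw [WithLp.prod_dist_eq_of_L2]
  simp only [stretch, Real.dist_eq, sq_abs, WithLp.toLp_fst, WithLp.toLp_snd]
  congr 2
  ring

theorem euclideanHausdorffMeasure_stretch_image {j : ℝ} (hj : 0 < j) (A : Set (ℝ × ℝ))
    (hA : MeasurableSet A) :
    μHE[2] (stretch j '' A) = ENNReal.ofReal j * volume A := by
  have h2 : Module.finrank ℝ (WithLp 2 (ℝ × ℝ)) = 2 := by
    rw [LinearEquiv.finrank_eq (WithLp.linearEquiv 2 ℝ (ℝ × ℝ))]
    simp
  have hv : (μHE[2] : Measure (WithLp 2 (ℝ × ℝ))) = volume := by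
    have := InnerProductSpace.euclideanHausdorffMeasure_eq_volume (V := WithLp 2 (ℝ × ℝ))
    rwa [h2] at this
  set l : (ℝ × ℝ) →ₗ[ℝ] (ℝ × ℝ) := LinearMap.prodMap (j • LinearMap.id) LinearMap.id with hl
  have hdet : LinearMap.det l = j := by
    rw [hl, LinearMap.det_prodMap]
    simp
  have him : stretch j '' A = WithLp.ofLp ⁻¹' (l '' A) := by
    ext x
    constructor
    · rintro ⟨a, ha, rfl⟩
      exact ⟨a, ha, by simp [hl, stretch]⟩
    · rintro ⟨a, ha, h⟩
      refine ⟨a, ha, ?_⟩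
      apply WithLp.ofLp_injective 2
      rw [← h]
      simp [hl, stretch]
  have hlm : MeasurableSet (l '' A) := by
    refine hA.image_of_continuousOn_injOn (l.continuous_of_finiteDimensional.continuousOn) ?_
    intro x _ y _ hxy
    simp only [hl, LinearMap.prodMap_apply, LinearMap.smul_apply, LinearMap.id_apply,
      smul_eq_mul, Prod.mk.injEq] at hxy
    exact Prod.ext (mul_left_cancel₀ hj.ne' hxy.1) hxy.2
  rw [hv, him, (WithLp.volume_preserving_ofLp ℝ ℝ).measure_preimage hlm.nullMeasurableSet,
    Measure.addHaar_image_linearMap, hdet, abs_of_pos hj]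

/-- Near `x`, `f` is almost isometric to a linear map that multiplies area by `J x`, and continuity
of `J` allows `J x` to be replaced by the nearby values `J a`. -/
theorem euclideanHausdorffMeasure_image_eq_lintegral {Y : Type*} [MetricSpace Y]
    [MeasurableSpace Y] [BorelSpace Y] {f : ℝ × ℝ → Y} {J : ℝ × ℝ → ℝ} {U : Set (ℝ × ℝ)}
    (hf : Continuous f) (hinj : InjOn f U) (hJ : Continuous J)
    (hJ0 : ∀ x, 0 < J x)
    (h : ∀ c : ℝ, 1 < c → ∀ x, ∀ᶠ p : (ℝ × ℝ) × (ℝ × ℝ) in 𝓝 (x, x),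
      dist (f p.1) (f p.2) ≤ c * dist (stretch (J x) p.1) (stretch (J x) p.2) ∧
      dist (stretch (J x) p.1) (stretch (J x) p.2) ≤ c * dist (f p.1) (f p.2)) :
    ∀ A ⊆ U, MeasurableSet A → μHE[2] (f '' A) = ∫⁻ x in A, ENNReal.ofReal (J x) := by
  intro A hAU hA
  rw [← withDensity_apply _ hA]
  refine measure_image_eq_of_locally_comparable hf hinj _ _ ?_ A hAU hA
  intro c hc x
  -- The factor `k ^ 2` is the cost of the distance comparison in dimension 2; the last `k` is the
  -- oscillation of `J`.
  obtain ⟨k, hk1, hkc⟩ : ∃ k : ℝ≥0, 1 < k ∧ k ^ 2 * k ≤ c := by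
    have : Tendsto (fun k : ℝ≥0 => k ^ 2 * k) (𝓝[>] 1) (𝓝 (1 ^ 2 * 1)) :=
      ((continuous_id.pow 2).mul continuous_id).continuousAt.tendsto.mono_left nhdsWithin_le_nhds
    have h1 := this.eventually (gt_mem_nhds (by simpa using hc))
    obtain ⟨k, hk, hk'⟩ := (h1.and self_mem_nhdsWithin).exists
    exact ⟨k, hk', hk.le⟩
  have hk1' : (1 : ℝ) < k := by exact_mod_cast hk1
  have e1 := h k hk1' x
  rw [nhds_prod_eq] at e1
  obtain ⟨W, hW, hWd⟩ := mem_prod_same_iff.1 e1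
  have e2 : ∀ᶠ y in 𝓝 x, J y < k * J x ∧ J x < k * J y := by
    have l1 : J x < k * J x := by nlinarith [hJ0 x]
    exact (hJ.continuousAt.eventually (gt_mem_nhds l1)).and
      ((continuousAt_const.mul hJ.continuousAt).eventually (lt_mem_nhds l1))
  refine ⟨_, inter_mem hW e2, ?_⟩
  intro S hS hSm
  have hSW : ∀ a ∈ S, a ∈ W := fun a ha => (hS ha).1
  have hSJ : ∀ a ∈ S, J a < k * J x ∧ J x < k * J a := fun a ha => (hS ha).2
  have m1 := euclideanHausdorffMeasure_image_le_of_dist_le 2 (f := f) (g := stretch (J x))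
    (A := S) (c := k) (fun a ha b hb => (@hWd (a, b) ⟨hSW a ha, hSW b hb⟩).1)
  have m2 := euclideanHausdorffMeasure_image_le_of_dist_le 2 (f := stretch (J x)) (g := f)
    (A := S) (c := k) (fun a ha b hb => (@hWd (a, b) ⟨hSW a ha, hSW b hb⟩).2)
  rw [euclideanHausdorffMeasure_stretch_image (hJ0 x) S hSm] at m1 m2
  rw [withDensity_apply _ hSm]
  have kc : (k : ℝ≥0∞) ^ 2 * k ≤ c := by exact_mod_cast hkc
  have hm : Measurable fun a => ENNReal.ofReal (J a) := by fun_prop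
  have j1 : ENNReal.ofReal (J x) * volume S ≤ k * ∫⁻ a in S, ENNReal.ofReal (J a) := by
    rw [← lintegral_const_mul _ hm, ← setLIntegral_const]
    refine setLIntegral_mono (hm.const_mul _) fun a ha => ?_
    rw [← ENNReal.ofReal_coe_nnreal, ← ENNReal.ofReal_mul (by positivity)]
    exact ENNReal.ofReal_le_ofReal (hSJ a ha).2.le
  have j2 : ∫⁻ a in S, ENNReal.ofReal (J a) ≤ k * (ENNReal.ofReal (J x) * volume S) := by
    rw [← mul_assoc, ← setLIntegral_const]
    refine setLIntegral_mono measurable_const fun a ha => ?_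
    rw [← ENNReal.ofReal_coe_nnreal, ← ENNReal.ofReal_mul (by positivity)]
    exact ENNReal.ofReal_le_ofReal (hSJ a ha).1.le
  constructor
  · calc _ ≤ _ := m1
      _ ≤ (k : ℝ≥0∞) ^ 2 * (k * ∫⁻ a in S, ENNReal.ofReal (J a)) := by gcongr
      _ ≤ _ := by rw [← mul_assoc]; gcongr
  · calc _ ≤ _ := j2
      _ ≤ (k : ℝ≥0∞) * (k ^ 2 * μHE[2] (f '' S)) := by gcongr
      _ = (k : ℝ≥0∞) ^ 2 * k * μHE[2] (f '' S) := by ring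
      _ ≤ _ := by gcongr

theorem euclideanHausdorffMeasure_one_image_eq {Y : Type*} [MetricSpace Y]
    [MeasurableSpace Y] [BorelSpace Y] {f : ℝ → Y} {j : ℝ} {U : Set ℝ}
    (hf : Continuous f) (hinj : InjOn f U) (hj : 0 < j)
    (h : ∀ c : ℝ, 1 < c → ∀ x, ∀ᶠ p : ℝ × ℝ in 𝓝 (x, x),
      dist (f p.1) (f p.2) ≤ c * dist (j * p.1) (j * p.2) ∧
      dist (j * p.1) (j * p.2) ≤ c * dist (f p.1) (f p.2)) :
    ∀ A ⊆ U, MeasurableSet A → μHE[1] (f '' A) = ENNReal.ofReal j * volume A := by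
  intro A hAU hA
  have hv : (μHE[1] : Measure ℝ) = volume := by
    have := InnerProductSpace.euclideanHausdorffMeasure_eq_volume (V := ℝ)
    rwa [Module.finrank_self] at this
  rw [← smul_eq_mul, ← Measure.smul_apply]
  refine measure_image_eq_of_locally_comparable hf hinj _ _ ?_ A hAU hA
  intro c hc x
  have e1 := h c hc x
  rw [nhds_prod_eq] at e1
  obtain ⟨W, hW, hWd⟩ := mem_prod_same_iff.1 e1
  refine ⟨_, hW, ?_⟩
  intro S hS hSm
  have m1 := euclideanHausdorffMeasure_image_le_of_dist_le 1 (f := f) (g := fun x => j * x)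
    (A := S) (c := c) (fun a ha b hb => (@hWd (a, b) ⟨hS ha, hS hb⟩).1)
  have m2 := euclideanHausdorffMeasure_image_le_of_dist_le 1 (f := fun x => j * x) (g := f)
    (A := S) (c := c) (fun a ha b hb => (@hWd (a, b) ⟨hS ha, hS hb⟩).2)
  have hs : μHE[1] ((fun x => j * x) '' S) = ENNReal.ofReal j * volume S := by
    rw [hv]
    have := Measure.addHaar_image_linearMap (volume : Measure ℝ) (j • LinearMap.id) S
    simpa [abs_of_pos hj] using this
  rw [hs, pow_one] at m1 m2
  exact ⟨m1, m2⟩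

/-- `4 sin² (x / 2)` is comparable to `x²` near `0`. -/
theorem eventually_sq_le_mul_sin_sq {c : ℝ} (hc : 1 < c) :
    ∀ᶠ x in 𝓝 (0 : ℝ), x ^ 2 ≤ c * (4 * Real.sin (x / 2) ^ 2) := by
  have h : ∀ᶠ x in 𝓝 (0 : ℝ), 1 < c * Real.sinc (x / 2) ^ 2 := by
    have : ContinuousAt (fun x : ℝ => c * Real.sinc (x / 2) ^ 2) 0 := by
      have := Real.continuous_sinc
      fun_prop
    exact this.eventually (lt_mem_nhds (by simpa using hc))
  filter_upwards [h] with x hx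
  by_cases h0 : x = 0
  · simp [h0]
  rw [Real.sinc_of_ne_zero (by simpa using h0)] at hx
  rw [div_pow, mul_div_assoc', lt_div_iff₀ (by positivity)] at hx
  nlinarith

theorem four_mul_sin_half_sq_le (x : ℝ) : 4 * Real.sin (x / 2) ^ 2 ≤ x ^ 2 := by
  have := sq_le_sq.2 (show |Real.sin (x / 2)| ≤ |x / 2| from Real.abs_sin_le_abs)
  nlinarith

/-! ### Coordinates in an orthonormal basis -/

theorem inner_basis (b : OrthonormalBasis (Fin 3) ℝ E3) (i j : Fin 3) :
    inner ℝ (b i) (b j) = if i = j then (1 : ℝ) else 0 :=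
  orthonormal_iff_ite.1 b.orthonormal i j

theorem inner_eq_coords (b : OrthonormalBasis (Fin 3) ℝ E3) (x y : E3) :
    inner ℝ x y = inner ℝ (b 0) x * inner ℝ (b 0) y + inner ℝ (b 1) x * inner ℝ (b 1) y +
      inner ℝ (b 2) x * inner ℝ (b 2) y := by
  rw [← b.sum_inner_mul_inner x y, Fin.sum_univ_three]
  simp only [real_inner_comm]

theorem norm_sq_eq_coords (b : OrthonormalBasis (Fin 3) ℝ E3) (x : E3) :
    ‖x‖ ^ 2 = inner ℝ (b 0) x ^ 2 + inner ℝ (b 1) x ^ 2 + inner ℝ (b 2) x ^ 2 := by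
  rw [← real_inner_self_eq_norm_sq, inner_eq_coords b]
  ring

theorem ext_coords (b : OrthonormalBasis (Fin 3) ℝ E3) {x y : E3}
    (h0 : inner ℝ (b 0) x = inner ℝ (b 0) y) (h1 : inner ℝ (b 1) x = inner ℝ (b 1) y)
    (h2 : inner ℝ (b 2) x = inner ℝ (b 2) y) : x = y := by
  rw [← sub_eq_zero, ← norm_eq_zero, ← sq_eq_zero_iff, norm_sq_eq_coords b]
  simp only [inner_sub_right, h0, h1, h2, sub_self]
  norm_num

/-! ### The parametrized torus -/

/-- The unit vector of angle `θ` in the plane of `b 0` and `b 1`. -/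
noncomputable def radial (b : OrthonormalBasis (Fin 3) ℝ E3) (θ : ℝ) : E3 :=
  Real.cos θ • b 0 + Real.sin θ • b 1

/-- The derivative of `radial b`. -/
noncomputable def angular (b : OrthonormalBasis (Fin 3) ℝ E3) (θ : ℝ) : E3 :=
  -Real.sin θ • b 0 + Real.cos θ • b 1

/-- The unit vector of longitude `θ` and latitude `φ`. -/
noncomputable def spherical (b : OrthonormalBasis (Fin 3) ℝ E3) (θ φ : ℝ) : E3 :=
  Real.cos φ • radial b θ + Real.sin φ • b 2

/-- The derivative of `spherical b θ`. -/
noncomputable def sphericalDeriv (b : OrthonormalBasis (Fin 3) ℝ E3) (θ φ : ℝ) : E3 :=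
  -Real.sin φ • radial b θ + Real.cos φ • b 2

/-- The torus of the pairs of a point of a circle and a unit vector of the same longitude. -/
noncomputable def normalTorus (O : E3) (ρ : ℝ) (b : OrthonormalBasis (Fin 3) ℝ E3) (x : ℝ × ℝ) :
    TE3 :=
  WithLp.toLp 2 (O + ρ • radial b x.1, spherical b x.1 x.2)

section

variable (O : E3) (ρ : ℝ) (b : OrthonormalBasis (Fin 3) ℝ E3) (θ φ : ℝ)

@[simp] theorem inner_radial_zero : inner ℝ (b 0) (radial b θ) = Real.cos θ := by
  simp [radial, inner_add_right, inner_smul_right]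

@[simp] theorem inner_radial_one : inner ℝ (b 1) (radial b θ) = Real.sin θ := by
  simp [radial, inner_add_right, inner_smul_right]

@[simp] theorem inner_radial_two : inner ℝ (b 2) (radial b θ) = 0 := by
  simp [radial, inner_add_right, inner_smul_right]

@[simp] theorem inner_angular_zero : inner ℝ (b 0) (angular b θ) = -Real.sin θ := by
  simp [angular, inner_add_right, inner_smul_right]

@[simp] theorem inner_angular_one : inner ℝ (b 1) (angular b θ) = Real.cos θ := by
  simp [angular, inner_add_right, inner_smul_right]

@[simp] theorem inner_angular_two : inner ℝ (b 2) (angular b θ) = 0 := by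
  simp [angular, inner_add_right, inner_smul_right]

@[simp] theorem inner_spherical_zero :
    inner ℝ (b 0) (spherical b θ φ) = Real.cos φ * Real.cos θ := by
  simp [spherical, inner_add_right, inner_smul_right]

@[simp] theorem inner_spherical_one :
    inner ℝ (b 1) (spherical b θ φ) = Real.cos φ * Real.sin θ := by
  simp [spherical, inner_add_right, inner_smul_right]

@[simp] theorem inner_spherical_two : inner ℝ (b 2) (spherical b θ φ) = Real.sin φ := by
  simp [spherical, inner_add_right, inner_smul_right]

@[simp] theorem inner_sphericalDeriv_zero :
    inner ℝ (b 0) (sphericalDeriv b θ φ) = -Real.sin φ * Real.cos θ := by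
  simp [sphericalDeriv, inner_add_right, inner_smul_right]

@[simp] theorem inner_sphericalDeriv_one :
    inner ℝ (b 1) (sphericalDeriv b θ φ) = -Real.sin φ * Real.sin θ := by
  simp [sphericalDeriv, inner_add_right, inner_smul_right]

@[simp] theorem inner_sphericalDeriv_two :
    inner ℝ (b 2) (sphericalDeriv b θ φ) = Real.cos φ := by
  simp [sphericalDeriv, inner_add_right, inner_smul_right]

@[simp] theorem normalTorus_fst (x : ℝ × ℝ) : (normalTorus O ρ b x).fst = O + ρ • radial b x.1 := rfl

@[simp] theorem normalTorus_snd (x : ℝ × ℝ) : (normalTorus O ρ b x).snd = spherical b x.1 x.2 := rfl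

theorem continuous_radial : Continuous (radial b) := by
  unfold radial
  fun_prop

theorem continuous_normalTorus : Continuous (normalTorus O ρ b) := by
  unfold normalTorus spherical radial
  refine (WithLp.prod_continuous_toLp 2 E3 E3).comp ?_
  fun_prop

theorem four_mul_sin_half_sub_sq (x y : ℝ) :
    4 * Real.sin ((x - y) / 2) ^ 2 =
      2 - 2 * (Real.cos x * Real.cos y + Real.sin x * Real.sin y) := by
  rw [← Real.cos_sub, show x - y = 2 * ((x - y) / 2) by ring, Real.cos_two_mul]
  have := Real.sin_sq_add_cos_sq ((x - y) / 2)
  rw [show 2 * ((x - y) / 2) / 2 = (x - y) / 2 by ring]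
  linarith

theorem dist_circle_sq (s t : ℝ) :
    dist (O + ρ • radial b s) (O + ρ • radial b t) ^ 2 =
      ρ ^ 2 * (4 * Real.sin ((s - t) / 2) ^ 2) := by
  rw [dist_eq_norm, norm_sq_eq_coords b, four_mul_sin_half_sub_sq]
  simp only [inner_sub_right, inner_add_right, inner_smul_right, inner_radial_zero,
    inner_radial_one, inner_radial_two]
  have h1 := Real.sin_sq_add_cos_sq s
  have h2 := Real.sin_sq_add_cos_sq t
  linear_combination ρ ^ 2 * h1 + ρ ^ 2 * h2

/-- The chord of the longitudes and that of the latitudes enter without a cross term, so the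
comparison with `stretch` reduces to `4 sin² (x / 2) ≈ x²` and the continuity of `cos`. -/
theorem dist_normalTorus_sq (x y : ℝ × ℝ) :
    dist (normalTorus O ρ b x) (normalTorus O ρ b y) ^ 2 =
      (ρ ^ 2 + Real.cos x.2 * Real.cos y.2) * (4 * Real.sin ((x.1 - y.1) / 2) ^ 2) +
        4 * Real.sin ((x.2 - y.2) / 2) ^ 2 := by
  rw [WithLp.prod_dist_eq_of_L2, Real.sq_sqrt (by positivity), normalTorus_fst, normalTorus_fst,
    dist_circle_sq, normalTorus_snd, normalTorus_snd, dist_eq_norm, norm_sq_eq_coords b,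
    four_mul_sin_half_sub_sq, four_mul_sin_half_sub_sq]
  simp only [inner_sub_right, inner_spherical_zero, inner_spherical_one, inner_spherical_two]
  have h1 := Real.sin_sq_add_cos_sq x.1
  have h2 := Real.sin_sq_add_cos_sq y.1
  have h3 := Real.sin_sq_add_cos_sq x.2
  have h4 := Real.sin_sq_add_cos_sq y.2
  linear_combination Real.cos x.2 ^ 2 * h1 + Real.cos y.2 ^ 2 * h2 + h3 + h4

end

/-! ### Length on the circle and area on the torus. -/

theorem eq_of_sin_half_sub_eq_zero {x y : ℝ} (h : Real.sin ((x - y) / 2) = 0)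
    (h1 : -(2 * Real.pi) < x - y) (h2 : x - y < 2 * Real.pi) : x = y := by
  have := (Real.sin_eq_zero_iff_of_lt_of_lt (by linarith) (by linarith)).1 h
  linarith

theorem injOn_circle (O : E3) {ρ : ℝ} (hρ : 0 < ρ) (b : OrthonormalBasis (Fin 3) ℝ E3) :
    InjOn (fun θ => O + ρ • radial b θ) (Ioc (-Real.pi) Real.pi) := by
  intro x hx y hy hxy
  have h := dist_circle_sq O ρ b x y
  rw [dist_eq_zero.2 hxy] at h
  have h' : Real.sin ((x - y) / 2) ^ 2 = 0 := by
    have : 0 < ρ ^ 2 := by positivity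
    nlinarith [sq_nonneg (Real.sin ((x - y) / 2))]
  exact eq_of_sin_half_sub_eq_zero (by simpa using h') (by linarith [hx.1, hy.2])
    (by linarith [hx.2, hy.1])

theorem injOn_normalTorus (O : E3) {ρ : ℝ} (hρ : 0 < ρ) (b : OrthonormalBasis (Fin 3) ℝ E3) {α : ℝ}
    (hα : α < Real.pi / 2) :
    InjOn (normalTorus O ρ b) (Ioc (-Real.pi) Real.pi ×ˢ Icc (-α) α) := by
  rintro ⟨s, t⟩ ⟨hs, ht⟩ ⟨s', t'⟩ ⟨hs', ht'⟩ hxy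
  have e1 : s = s' := injOn_circle O hρ b hs hs' (congrArg WithLp.fst hxy)
  subst e1
  have h := dist_normalTorus_sq O ρ b (s, t) (s, t')
  rw [dist_eq_zero.2 hxy] at h
  simp only [sub_self, zero_div, Real.sin_zero] at h
  have e2 : t = t' := eq_of_sin_half_sub_eq_zero (by simpa using h)
    (by linarith [ht.1, ht'.2, Real.pi_pos]) (by linarith [ht.2, ht'.1, Real.pi_pos])
  rw [e2]

theorem le_mul_of_sq_le {a b c : ℝ} (hb : 0 ≤ b) (hc : 0 ≤ c) (h : a ^ 2 ≤ c ^ 2 * b ^ 2) :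
    a ≤ c * b :=
  abs_le_of_sq_le_sq' (by rwa [mul_pow]) (by positivity) |>.2

theorem euclideanHausdorffMeasure_circle (O : E3) {ρ : ℝ} (hρ : 0 < ρ)
    (b : OrthonormalBasis (Fin 3) ℝ E3) {A : Set ℝ} (hA : A ⊆ Ioc (-Real.pi) Real.pi)
    (hAm : MeasurableSet A) :
    μHE[1] ((fun θ => O + ρ • radial b θ) '' A) = ENNReal.ofReal ρ * volume A := by
  have hcont := continuous_radial b
  refine euclideanHausdorffMeasure_one_image_eq (by fun_prop) (injOn_circle O hρ b) hρ ?_ A hA hAm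
  intro c hc x
  have ht : Tendsto (fun p : ℝ × ℝ => p.1 - p.2) (𝓝 (x, x)) (𝓝 0) := by
    have : Continuous fun p : ℝ × ℝ => p.1 - p.2 := by fun_prop
    simpa using this.tendsto (x, x)
  filter_upwards [ht.eventually (eventually_sq_le_mul_sin_sq hc)] with p hp
  have h1 := four_mul_sin_half_sq_le (p.1 - p.2)
  have hd : dist (ρ * p.1) (ρ * p.2) ^ 2 = ρ ^ 2 * (p.1 - p.2) ^ 2 := by
    rw [Real.dist_eq, sq_abs]
    ring
  constructor
  · refine le_mul_of_sq_le dist_nonneg (by positivity) ?_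
    rw [dist_circle_sq, hd]
    calc _ ≤ ρ ^ 2 * (p.1 - p.2) ^ 2 := by gcongr
      _ ≤ _ := le_mul_of_one_le_left (by positivity) (by nlinarith)
  · refine le_mul_of_sq_le dist_nonneg (by positivity) ?_
    rw [dist_circle_sq, hd]
    have : c * (4 * Real.sin ((p.1 - p.2) / 2) ^ 2) ≤
      c ^ 2 * (4 * Real.sin ((p.1 - p.2) / 2) ^ 2) := by
      gcongr
      nlinarith
    calc _ ≤ ρ ^ 2 * (c ^ 2 * (4 * Real.sin ((p.1 - p.2) / 2) ^ 2)) := by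
          gcongr
          exact hp.trans this
      _ = _ := by ring

/-- The Jacobian of `normalTorus`. -/
noncomputable def torusJac (ρ : ℝ) (x : ℝ × ℝ) : ℝ := √(ρ ^ 2 + Real.cos x.2 ^ 2)

theorem torusJac_pos {ρ : ℝ} (hρ : 0 < ρ) (x : ℝ × ℝ) : 0 < torusJac ρ x :=
  Real.sqrt_pos.2 (by positivity)

theorem continuous_torusJac (ρ : ℝ) : Continuous (torusJac ρ) := by
  unfold torusJac
  fun_prop

theorem euclideanHausdorffMeasure_normalTorus (O : E3) {ρ : ℝ} (hρ : 0 < ρ)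
    (b : OrthonormalBasis (Fin 3) ℝ E3) {α : ℝ} (hα : α < Real.pi / 2) {A : Set (ℝ × ℝ)}
    (hA : A ⊆ Ioc (-Real.pi) Real.pi ×ˢ Icc (-α) α) (hAm : MeasurableSet A) :
    μHE[2] (normalTorus O ρ b '' A) = ∫⁻ x in A, ENNReal.ofReal (torusJac ρ x) := by
  refine euclideanHausdorffMeasure_image_eq_lintegral (continuous_normalTorus O ρ b)
    (injOn_normalTorus O hρ b hα) (continuous_torusJac ρ) (torusJac_pos hρ) ?_ A hA hAm
  intro c hc x
  have ht1 : Tendsto (fun p : (ℝ × ℝ) × (ℝ × ℝ) => p.1.1 - p.2.1) (𝓝 (x, x)) (𝓝 0) := by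
    have : Continuous fun p : (ℝ × ℝ) × (ℝ × ℝ) => p.1.1 - p.2.1 := by fun_prop
    simpa using this.tendsto (x, x)
  have ht2 : Tendsto (fun p : (ℝ × ℝ) × (ℝ × ℝ) => p.1.2 - p.2.2) (𝓝 (x, x)) (𝓝 0) := by
    have : Continuous fun p : (ℝ × ℝ) × (ℝ × ℝ) => p.1.2 - p.2.2 := by fun_prop
    simpa using this.tendsto (x, x)
  have hJ : torusJac ρ x ^ 2 = ρ ^ 2 + Real.cos x.2 ^ 2 := Real.sq_sqrt (by positivity)
  have hk : Continuous fun p : (ℝ × ℝ) × (ℝ × ℝ) => ρ ^ 2 + Real.cos p.1.2 * Real.cos p.2.2 := by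
    fun_prop
  have hpos : 0 < torusJac ρ x ^ 2 := by have := torusJac_pos hρ x; positivity
  have hk1 : ∀ᶠ p in 𝓝 (x, x), ρ ^ 2 + Real.cos p.1.2 * Real.cos p.2.2 <
      c * torusJac ρ x ^ 2 := by
    refine hk.continuousAt.eventually (gt_mem_nhds ?_)
    change ρ ^ 2 + Real.cos x.2 * Real.cos x.2 < c * torusJac ρ x ^ 2
    rw [← sq, ← hJ]
    nlinarith
  have hk2 : ∀ᶠ p in 𝓝 (x, x), torusJac ρ x ^ 2 <
      c * (ρ ^ 2 + Real.cos p.1.2 * Real.cos p.2.2) := by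
    refine (continuousAt_const.mul hk.continuousAt).eventually (lt_mem_nhds ?_)
    change torusJac ρ x ^ 2 < c * (ρ ^ 2 + Real.cos x.2 * Real.cos x.2)
    rw [← sq, ← hJ]
    nlinarith
  filter_upwards [ht1.eventually (eventually_sq_le_mul_sin_sq hc),
    ht2.eventually (eventually_sq_le_mul_sin_sq hc), hk1, hk2] with p h1 h2 h3 h4
  have h5 := four_mul_sin_half_sq_le (p.1.1 - p.2.1)
  have h6 := four_mul_sin_half_sq_le (p.1.2 - p.2.2)
  have hd : dist (stretch (torusJac ρ x) p.1) (stretch (torusJac ρ x) p.2) ^ 2 =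
      torusJac ρ x ^ 2 * (p.1.1 - p.2.1) ^ 2 + (p.1.2 - p.2.2) ^ 2 := by
    rw [dist_stretch, Real.sq_sqrt (by positivity)]
  -- Each comparison costs a factor `c` at most twice, once for the coefficient and once for the
  -- sine; this matches the `c ^ 2` of squared distances.
  have hc2 : c ≤ c ^ 2 := by nlinarith
  have hkp : 0 ≤ ρ ^ 2 + Real.cos p.1.2 * Real.cos p.2.2 := by
    by_contra hneg
    push Not at hneg
    nlinarith
  set K := ρ ^ 2 + Real.cos p.1.2 * Real.cos p.2.2
  set j := torusJac ρ x
  constructor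
  · refine le_mul_of_sq_le dist_nonneg (by positivity) ?_
    rw [dist_normalTorus_sq, hd]
    calc _ ≤ c * j ^ 2 * (p.1.1 - p.2.1) ^ 2 + (p.1.2 - p.2.2) ^ 2 := by gcongr
      _ ≤ c ^ 2 * j ^ 2 * (p.1.1 - p.2.1) ^ 2 + c ^ 2 * (p.1.2 - p.2.2) ^ 2 := by
        gcongr
        exact le_mul_of_one_le_left (by positivity) (by linarith)
      _ = _ := by ring
  · refine le_mul_of_sq_le dist_nonneg (by positivity) ?_
    rw [dist_normalTorus_sq, hd]
    calc _ ≤ (c * K) * (c * (4 * Real.sin ((p.1.1 - p.2.1) / 2) ^ 2)) +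
          c * (4 * Real.sin ((p.1.2 - p.2.2) / 2) ^ 2) := by gcongr
      _ ≤ (c * K) * (c * (4 * Real.sin ((p.1.1 - p.2.1) / 2) ^ 2)) +
          c ^ 2 * (4 * Real.sin ((p.1.2 - p.2.2) / 2) ^ 2) := by gcongr
      _ = _ := by ring

theorem restrict_normalTorus_image (O : E3) {ρ : ℝ} (hρ : 0 < ρ)
    (b : OrthonormalBasis (Fin 3) ℝ E3) {α : ℝ} (hα : α < Real.pi / 2) {A : Set (ℝ × ℝ)}
    (hA : A ⊆ Ioc (-Real.pi) Real.pi ×ˢ Icc (-α) α) (hAm : MeasurableSet A) :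
    (μHE[2] : Measure TE3).restrict (normalTorus O ρ b '' A) =
      ((volume.restrict A).withDensity fun x => ENNReal.ofReal (torusJac ρ x)).map
        (normalTorus O ρ b) := by
  have hm := (continuous_normalTorus O ρ b).measurable
  ext S hS
  rw [Measure.restrict_apply hS, Measure.map_apply hm hS, withDensity_apply _ (hm hS),
    Measure.restrict_restrict (hm hS), ← euclideanHausdorffMeasure_normalTorus O hρ b hα
      (inter_subset_right.trans hA) ((hm hS).inter hAm), image_preimage_inter]

theorem setIntegral_normalTorus_image (O : E3) {ρ : ℝ} (hρ : 0 < ρ)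
    (b : OrthonormalBasis (Fin 3) ℝ E3) {α : ℝ} (hα : α < Real.pi / 2) {A : Set (ℝ × ℝ)}
    (hA : A ⊆ Ioc (-Real.pi) Real.pi ×ˢ Icc (-α) α) (hAm : MeasurableSet A)
    {g : TE3 → ℝ} (hg : Measurable g) :
    ∫ p in normalTorus O ρ b '' A, g p ∂μHE[2] =
      ∫ x in A, torusJac ρ x * g (normalTorus O ρ b x) := by
  rw [restrict_normalTorus_image O hρ b hα hA hAm,
    integral_map (continuous_normalTorus O ρ b).aemeasurable hg.aestronglyMeasurable]
  have hm : Measurable fun x => (torusJac ρ x).toNNReal :=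
    (continuous_torusJac ρ).measurable.real_toNNReal
  have := integral_withDensity_eq_integral_smul (μ := volume.restrict A) hm
    (fun x => g (normalTorus O ρ b x))
  refine this.trans (integral_congr_ae (.of_forall fun x => ?_))
  simp only [NNReal.smul_def, smul_eq_mul, Real.coe_toNNReal _ (torusJac_pos hρ x).le]

/-! ### Independence of the choice of frames -/

/-- Multiplicativity of the determinant: the matrix of `x, y, z` is their coordinate matrix in `b`
times the matrix of `b`. -/
theorem det3_eq_coords (b : OrthonormalBasis (Fin 3) ℝ E3) (x y z : E3) :
    det3 x y z = det3 (b 0) (b 1) (b 2) *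
      Matrix.det !![inner ℝ (b 0) x, inner ℝ (b 1) x, inner ℝ (b 2) x;
        inner ℝ (b 0) y, inner ℝ (b 1) y, inner ℝ (b 2) y;
        inner ℝ (b 0) z, inner ℝ (b 1) z, inner ℝ (b 2) z] := by
  have h : ∀ (u : E3) (i : Fin 3), u i = inner ℝ (b 0) u * b 0 i + inner ℝ (b 1) u * b 1 i +
      inner ℝ (b 2) u * b 2 i := by
    intro u i
    conv_lhs => rw [← b.sum_repr' u, Fin.sum_univ_three]
    simp
  simp only [det3]
  rw [h x 0, h x 1, h x 2, h y 0, h y 1, h y 2, h z 0, h z 1, h z 2]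
  simp only [Matrix.det_fin_three, Matrix.of_apply, Matrix.cons_val', Matrix.cons_val_zero,
    Matrix.cons_val_one, Matrix.cons_val, Matrix.cons_val_fin_one]
  ring

/-- The transition matrix between two orthonormal bases of a plane is orthogonal. The sign of its
determinant is settled later by orientation. -/
theorem exists_coeffs_of_orthonormal_of_mem_span {V : Type*} [NormedAddCommGroup V]
    [InnerProductSpace ℝ V] {a a' : Fin 2 → V} (ha : Orthonormal ℝ a) (ha' : Orthonormal ℝ a')
    (h : ∀ i, a' i ∈ Submodule.span ℝ (Set.range a)) :
    ∃ p q r s : ℝ, a' 0 = p • a 0 + q • a 1 ∧ a' 1 = r • a 0 + s • a 1 ∧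
      (p * s - q * r) ^ 2 = 1 := by
  have hr : Set.range a = {a 0, a 1} := by
    ext x
    simp [Fin.exists_fin_two, eq_comm]
  simp only [hr, Submodule.mem_span_pair] at h
  obtain ⟨p, q, h0⟩ := h 0
  obtain ⟨r, s, h1⟩ := h 1
  refine ⟨p, q, r, s, h0.symm, h1.symm, ?_⟩
  have o := orthonormal_iff_ite.1 ha
  have o' := orthonormal_iff_ite.1 ha'
  have e00 := o' 0 0
  have e01 := o' 0 1
  have e11 := o' 1 1
  rw [← h0] at e00 e01
  rw [← h1] at e01 e11
  simp only [inner_add_left, inner_add_right, inner_smul_left, inner_smul_right, o] at e00 e01 e11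
  simp at e00 e01 e11
  -- Lagrange's identity `(p² + q²)(r² + s²) − (pr + qs)² = (ps − qr)²`.
  linear_combination (r * r + s * s) * e00 + e11 - (p * r + q * s) * e01

/-- The linear coefficient of the invariant form of the frame `(e, f)`. -/
noncomputable def frameForm₁ (e f : E3) (v w : TE3) : ℝ :=
  inner ℝ e v.fst * inner ℝ f w.snd + inner ℝ e v.snd * inner ℝ f w.fst -
    inner ℝ f v.fst * inner ℝ e w.snd - inner ℝ f v.snd * inner ℝ e w.fst

/-- The quadratic coefficient of the invariant form of the frame `(e, f)`. -/
noncomputable def frameForm₂ (e f : E3) (v w : TE3) : ℝ :=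
  inner ℝ e v.snd * inner ℝ f w.snd - inner ℝ f v.snd * inner ℝ e w.snd

theorem invariantForm_apply (k : ℕ) (p : TE3) (v : Fin 2 → TE3) :
    invariantForm k p v =
      ((Polynomial.C (inner ℝ (directFrame p.snd 0) (v 0).fst) +
        Polynomial.X * Polynomial.C (inner ℝ (directFrame p.snd 0) (v 0).snd)) *
      (Polynomial.C (inner ℝ (directFrame p.snd 1) (v 1).fst) +
        Polynomial.X * Polynomial.C (inner ℝ (directFrame p.snd 1) (v 1).snd)) -
      (Polynomial.C (inner ℝ (directFrame p.snd 1) (v 0).fst) +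
        Polynomial.X * Polynomial.C (inner ℝ (directFrame p.snd 1) (v 0).snd)) *
      (Polynomial.C (inner ℝ (directFrame p.snd 0) (v 1).fst) +
        Polynomial.X * Polynomial.C (inner ℝ (directFrame p.snd 0) (v 1).snd))).coeff k :=
  congrArg (fun P : ℝ[X] => P.coeff k) (Matrix.det_fin_two _)

theorem coeff_one_frame (a b c d a' b' c' d' : ℝ) :
    ((Polynomial.C a + Polynomial.X * Polynomial.C b) *
      (Polynomial.C c + Polynomial.X * Polynomial.C d) -
      (Polynomial.C a' + Polynomial.X * Polynomial.C b') *
      (Polynomial.C c' + Polynomial.X * Polynomial.C d')).coeff 1 =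
      a * d + b * c - a' * d' - b' * c' ∧
    ((Polynomial.C a + Polynomial.X * Polynomial.C b) *
      (Polynomial.C c + Polynomial.X * Polynomial.C d) -
      (Polynomial.C a' + Polynomial.X * Polynomial.C b') *
      (Polynomial.C c' + Polynomial.X * Polynomial.C d')).coeff 2 = b * d - b' * d' := by
  have h : (Polynomial.C a + Polynomial.X * Polynomial.C b) *
      (Polynomial.C c + Polynomial.X * Polynomial.C d) -
      (Polynomial.C a' + Polynomial.X * Polynomial.C b') *
      (Polynomial.C c' + Polynomial.X * Polynomial.C d') =
      Polynomial.C (b * d - b' * d') * Polynomial.X ^ 2 +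
      Polynomial.C (a * d + b * c - a' * d' - b' * c') * Polynomial.X +
      Polynomial.C (a * c - a' * c') := by
    simp only [map_sub, map_mul, map_add]
    ring
  rw [h]
  constructor
  all_goals
    simp only [Polynomial.coeff_add, Polynomial.coeff_C_mul, Polynomial.coeff_X_pow,
      Polynomial.coeff_X, Polynomial.coeff_C]
    norm_num

theorem invariantForm_one (p : TE3) (v : Fin 2 → TE3) :
    invariantForm 1 p v = frameForm₁ (directFrame p.snd 0) (directFrame p.snd 1) (v 0) (v 1) := by
  rw [invariantForm_apply, (coeff_one_frame _ _ _ _ _ _ _ _).1, frameForm₁]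

theorem invariantForm_two (p : TE3) (v : Fin 2 → TE3) :
    invariantForm 2 p v = frameForm₂ (directFrame p.snd 0) (directFrame p.snd 1) (v 0) (v 1) := by
  rw [invariantForm_apply, (coeff_one_frame _ _ _ _ _ _ _ _).2, frameForm₂]

theorem det3_smul_add_smul (a₀ a₁ c : E3) (p q r s : ℝ) :
    det3 (p • a₀ + q • a₁) (r • a₀ + s • a₁) c = (p * s - q * r) * det3 a₀ a₁ c := by
  simp only [det3, PiLp.add_apply, PiLp.smul_apply, smul_eq_mul, Matrix.det_fin_three,
    Matrix.of_apply, Matrix.cons_val', Matrix.cons_val_zero,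
    Matrix.cons_val_one, Matrix.cons_val, Matrix.cons_val_fin_one]
  ring

theorem eq_one_of_sq_eq_one_of_pos {t x y : ℝ} (ht : t ^ 2 = 1) (hx : 0 < x) (hy : 0 < y)
    (h : y = t * x) : t = 1 := by
  rcases eq_or_eq_neg_of_sq_eq_sq t 1 (by rw [ht, one_pow]) with h1 | h1
  · exact h1
  · rw [h1] at h
    linarith

theorem orthonormal_pair_iff {V : Type*} [NormedAddCommGroup V] [InnerProductSpace ℝ V]
    (a : Fin 2 → V) : Orthonormal ℝ a ↔
      inner ℝ (a 0) (a 0) = 1 ∧ inner ℝ (a 1) (a 1) = 1 ∧ inner ℝ (a 0) (a 1) = 0 := by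
  rw [orthonormal_iff_ite]
  constructor
  · intro h
    exact ⟨by simpa using h 0 0, by simpa using h 1 1, by simpa using h 0 1⟩
  · rintro ⟨h0, h1, h2⟩ i j
    fin_cases i <;> fin_cases j <;> simp_all [real_inner_comm]

/-! ### The moving frame `(angular, sphericalDeriv, spherical)`. -/

section

variable (b : OrthonormalBasis (Fin 3) ℝ E3) (θ φ : ℝ)

/-- Expansion in the orthonormal moving frame. At `φ = 0` this frame is `(angular b θ, b 2, radial b
θ)`, which serves for base points. -/
theorem decomp_spherical (y : E3) :
    y = inner ℝ (angular b θ) y • angular b θ +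
      inner ℝ (sphericalDeriv b θ φ) y • sphericalDeriv b θ φ +
      inner ℝ (spherical b θ φ) y • spherical b θ φ := by
  have h1 := Real.sin_sq_add_cos_sq θ
  have h2 := Real.sin_sq_add_cos_sq φ
  have hh : ∀ z : E3, inner ℝ z y = inner ℝ (b 0) z * inner ℝ (b 0) y +
      inner ℝ (b 1) z * inner ℝ (b 1) y + inner ℝ (b 2) z * inner ℝ (b 2) y := fun z =>
    inner_eq_coords b z y
  apply ext_coords b
  all_goals
    simp only [inner_add_right, inner_smul_right]
    rw [hh (angular b θ), hh (sphericalDeriv b θ φ), hh (spherical b θ φ)]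
    simp only [inner_angular_zero, inner_angular_one, inner_angular_two, inner_sphericalDeriv_zero,
      inner_sphericalDeriv_one, inner_sphericalDeriv_two, inner_spherical_zero,
      inner_spherical_one, inner_spherical_two]
  · generalize inner ℝ (b 0) y = y0, inner ℝ (b 1) y = y1, inner ℝ (b 2) y = y2
    linear_combination (-y0) * h1 - (Real.cos θ ^ 2 * y0 + Real.cos θ * Real.sin θ * y1) * h2
  · generalize inner ℝ (b 0) y = y0, inner ℝ (b 1) y = y1, inner ℝ (b 2) y = y2
    linear_combination (-y1) * h1 - (Real.sin θ ^ 2 * y1 + Real.cos θ * Real.sin θ * y0) * h2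
  · generalize inner ℝ (b 0) y = y0, inner ℝ (b 1) y = y1, inner ℝ (b 2) y = y2
    linear_combination (-y2) * h2

theorem inner_angular_self : inner ℝ (angular b θ) (angular b θ) = (1 : ℝ) := by
  have h1 := Real.sin_sq_add_cos_sq θ
  rw [inner_eq_coords b]
  simp only [inner_angular_zero, inner_angular_one, inner_angular_two]
  linear_combination h1

theorem inner_sphericalDeriv_self :
    inner ℝ (sphericalDeriv b θ φ) (sphericalDeriv b θ φ) = (1 : ℝ) := by
  have h1 := Real.sin_sq_add_cos_sq θ
  have h2 := Real.sin_sq_add_cos_sq φ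
  rw [inner_eq_coords b]
  simp only [inner_sphericalDeriv_zero, inner_sphericalDeriv_one, inner_sphericalDeriv_two]
  linear_combination (Real.sin φ ^ 2) * h1 + h2

theorem inner_spherical_self :
    inner ℝ (spherical b θ φ) (spherical b θ φ) = (1 : ℝ) := by
  have h1 := Real.sin_sq_add_cos_sq θ
  have h2 := Real.sin_sq_add_cos_sq φ
  rw [inner_eq_coords b]
  simp only [inner_spherical_zero, inner_spherical_one, inner_spherical_two]
  linear_combination (Real.cos φ ^ 2) * h1 + h2

theorem inner_angular_sphericalDeriv :
    inner ℝ (angular b θ) (sphericalDeriv b θ φ) = (0 : ℝ) := by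
  rw [inner_eq_coords b]
  simp only [inner_sphericalDeriv_zero, inner_sphericalDeriv_one, inner_sphericalDeriv_two,
    inner_angular_zero, inner_angular_one, inner_angular_two]
  ring

theorem inner_angular_spherical :
    inner ℝ (angular b θ) (spherical b θ φ) = (0 : ℝ) := by
  rw [inner_eq_coords b]
  simp only [inner_spherical_zero, inner_spherical_one, inner_spherical_two,
    inner_angular_zero, inner_angular_one, inner_angular_two]
  ring

theorem inner_sphericalDeriv_spherical :
    inner ℝ (sphericalDeriv b θ φ) (spherical b θ φ) = (0 : ℝ) := by
  have h1 := Real.sin_sq_add_cos_sq θ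
  rw [inner_eq_coords b]
  simp only [inner_spherical_zero, inner_spherical_one, inner_spherical_two,
    inner_sphericalDeriv_zero, inner_sphericalDeriv_one, inner_sphericalDeriv_two]
  linear_combination (-Real.sin φ * Real.cos φ) * h1

theorem det3_frame_spherical : det3 (angular b θ) (sphericalDeriv b θ φ) (spherical b θ φ) =
    det3 (b 0) (b 1) (b 2) := by
  have h1 := Real.sin_sq_add_cos_sq θ
  have h2 := Real.sin_sq_add_cos_sq φ
  rw [det3_eq_coords b]
  simp only [Matrix.det_fin_three, Matrix.of_apply, Matrix.cons_val', Matrix.cons_val_zero,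
    Matrix.cons_val_one, Matrix.cons_val, Matrix.cons_val_fin_one, inner_spherical_zero,
    inner_spherical_one, inner_spherical_two,
    inner_sphericalDeriv_zero, inner_sphericalDeriv_one, inner_sphericalDeriv_two,
    inner_angular_zero, inner_angular_one, inner_angular_two]
  linear_combination (det3 (b 0) (b 1) (b 2)) * (h2 + (Real.sin φ ^ 2 + Real.cos φ ^ 2) * h1)

variable (hb : 0 < det3 (b 0) (b 1) (b 2))
include hb

theorem isDirectFrame_spherical :
    IsDirectFrame (spherical b θ φ) ![angular b θ, sphericalDeriv b θ φ] := by
  refine ⟨(orthonormal_pair_iff _).2 ⟨?_, ?_, ?_⟩, fun i => ?_, ?_⟩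
  · exact inner_angular_self b θ
  · exact inner_sphericalDeriv_self b θ φ
  · exact inner_angular_sphericalDeriv b θ φ
  · fin_cases i
    · exact inner_angular_spherical b θ φ
    · exact inner_sphericalDeriv_spherical b θ φ
  · exact (det3_frame_spherical b θ φ).symm ▸ hb

/-- The chosen frame and the explicit one are orthonormal in the same plane `ξ⊥` with the same
orientation, hence differ by a rotation. -/
theorem directFrame_spherical :
    ∃ p q r s : ℝ, directFrame (spherical b θ φ) 0 =
        p • angular b θ + q • sphericalDeriv b θ φ ∧
      directFrame (spherical b θ φ) 1 = r • angular b θ + s • sphericalDeriv b θ φ ∧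
      p * s - q * r = 1 := by
  have h0 := isDirectFrame_spherical b θ φ hb
  have hex : ∃ e, IsDirectFrame (spherical b θ φ) e := ⟨_, h0⟩
  have hd : IsDirectFrame (spherical b θ φ) (directFrame (spherical b θ φ)) := by
    rw [directFrame, dif_pos hex]
    exact hex.choose_spec
  set e := directFrame (spherical b θ φ)
  obtain ⟨p, q, r, s, hp, hr, hdet⟩ :=
    exists_coeffs_of_orthonormal_of_mem_span h0.1 hd.1 (fun i => by
      rw [decomp_spherical b θ φ (e i), real_inner_comm (e i) (spherical b θ φ), hd.2.1 i,
        zero_smul, add_zero]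
      refine add_mem (Submodule.smul_mem _ _ (Submodule.subset_span ⟨0, rfl⟩))
        (Submodule.smul_mem _ _ (Submodule.subset_span ⟨1, rfl⟩)))
  refine ⟨p, q, r, s, hp, hr, eq_one_of_sq_eq_one_of_pos hdet h0.2.2 hd.2.2 ?_⟩
  rw [hp, hr, det3_smul_add_smul]

/-- Both forms are alternating in the frame, so a change of frame multiplies them by its
determinant, here `1`. -/
theorem frameForm_directFrame (v w : TE3) :
    frameForm₁ (directFrame (spherical b θ φ) 0) (directFrame (spherical b θ φ) 1) v w =
      frameForm₁ (angular b θ) (sphericalDeriv b θ φ) v w ∧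
    frameForm₂ (directFrame (spherical b θ φ) 0) (directFrame (spherical b θ φ) 1) v w =
      frameForm₂ (angular b θ) (sphericalDeriv b θ φ) v w := by
  obtain ⟨p, q, r, s, hp, hr, h⟩ := directFrame_spherical b θ φ hb
  rw [hp, hr]
  simp only [frameForm₁, frameForm₂, inner_add_left, inner_smul_left, RCLike.conj_to_real]
  constructor
  · linear_combination (inner ℝ (angular b θ) v.fst * inner ℝ (sphericalDeriv b θ φ) w.snd +
      inner ℝ (angular b θ) v.snd * inner ℝ (sphericalDeriv b θ φ) w.fst -
      inner ℝ (sphericalDeriv b θ φ) v.fst * inner ℝ (angular b θ) w.snd -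
      inner ℝ (sphericalDeriv b θ φ) v.snd * inner ℝ (angular b θ) w.fst) * h
  · linear_combination (inner ℝ (angular b θ) v.snd * inner ℝ (sphericalDeriv b θ φ) w.snd -
      inner ℝ (sphericalDeriv b θ φ) v.snd * inner ℝ (angular b θ) w.snd) * h

end

/-- The orthonormal frame of the tangent plane of `normalTorus` given by its partial
derivatives. -/
noncomputable def torusFrame (ρ : ℝ) (b : OrthonormalBasis (Fin 3) ℝ E3) (x : ℝ × ℝ) :
    Fin 2 → TE3 :=
  ![(torusJac ρ x)⁻¹ • WithLp.toLp 2 (ρ • angular b x.1, Real.cos x.2 • angular b x.1),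
    WithLp.toLp 2 (0, sphericalDeriv b x.1 x.2)]

section

variable {ρ : ℝ} (hρ : 0 < ρ) (b : OrthonormalBasis (Fin 3) ℝ E3) (x : ℝ × ℝ)
include hρ

theorem orthonormal_torusFrame : Orthonormal ℝ (torusFrame ρ b x) := by
  have hJ : torusJac ρ x ^ 2 = ρ ^ 2 + Real.cos x.2 ^ 2 := Real.sq_sqrt (by positivity)
  have hJ0 := (torusJac_pos hρ x).ne'
  refine (orthonormal_pair_iff _).2 ⟨?_, ?_, ?_⟩
  · simp only [torusFrame, Matrix.cons_val_zero, inner_smul_left, inner_smul_right,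
      WithLp.prod_inner_apply, inner_angular_self, RCLike.conj_to_real]
    field_simp
    linear_combination -hJ
  · simp [torusFrame, WithLp.prod_inner_apply, -inner_self_eq_norm_sq_to_K,
      inner_sphericalDeriv_self]
  · simp [torusFrame, WithLp.prod_inner_apply, inner_smul_left,
      inner_angular_sphericalDeriv]

variable (hb : 0 < det3 (b 0) (b 1) (b 2)) (hx : 0 < Real.cos x.2)
include hb hx

/-- The chosen tangent frame is a rotation of `torusFrame`, so the alternating forms may be
evaluated on `torusFrame`. Its second vector has no base component, which leaves one product in each
form. -/
theorem invariantForm_positiveTangentFrame {O : E3} {S : Set TE3}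
    (hS : tangentConeAt ℝ S (normalTorus O ρ b x) =
      Submodule.span ℝ (Set.range (torusFrame ρ b x))) :
    invariantForm 1 (normalTorus O ρ b x) (positiveTangentFrame S (normalTorus O ρ b x)) =
      ρ / torusJac ρ x ∧
    invariantForm 2 (normalTorus O ρ b x) (positiveTangentFrame S (normalTorus O ρ b x)) =
      Real.cos x.2 / torusJac ρ x := by
  have hJ0 := torusJac_pos hρ x
  have h0 : IsPositiveTangentFrame S (normalTorus O ρ b x) (torusFrame ρ b x) := by
    refine ⟨orthonormal_torusFrame hρ b x, hS.symm, ?_⟩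
    -- The sums of components are `(ρ + cos φ) / J` times `angular` and exactly `sphericalDeriv`;
    -- hence the orientation is positive as soon as `cos φ > 0`.
    have : det3 ((torusFrame ρ b x 0).fst + (torusFrame ρ b x 0).snd)
        ((torusFrame ρ b x 1).fst + (torusFrame ρ b x 1).snd) (normalTorus O ρ b x).snd =
        (torusJac ρ x)⁻¹ * (ρ + Real.cos x.2) * det3 (b 0) (b 1) (b 2) := by
      rw [← det3_frame_spherical b x.1 x.2]
      have e1 : (torusFrame ρ b x 0).fst + (torusFrame ρ b x 0).snd =
          ((torusJac ρ x)⁻¹ * (ρ + Real.cos x.2)) • angular b x.1 +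
            (0 : ℝ) • sphericalDeriv b x.1 x.2 := by
        simp only [torusFrame, Matrix.cons_val_zero, WithLp.smul_fst, WithLp.smul_snd,
          WithLp.toLp_fst, WithLp.toLp_snd]
        module
      have e2 : (torusFrame ρ b x 1).fst + (torusFrame ρ b x 1).snd =
          (0 : ℝ) • angular b x.1 + (1 : ℝ) • sphericalDeriv b x.1 x.2 := by
        simp [torusFrame]
      rw [e1, e2, det3_smul_add_smul, normalTorus_snd]
      ring
    rw [this]
    positivity
  have hex : ∃ a, IsPositiveTangentFrame S (normalTorus O ρ b x) a := ⟨_, h0⟩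
  have hd : IsPositiveTangentFrame S (normalTorus O ρ b x)
      (positiveTangentFrame S (normalTorus O ρ b x)) := by
    rw [positiveTangentFrame, dif_pos hex]
    exact hex.choose_spec
  set a := positiveTangentFrame S (normalTorus O ρ b x)
  obtain ⟨p, q, r, s, hp, hr, hdet⟩ :=
    exists_coeffs_of_orthonormal_of_mem_span h0.1 hd.1 (fun i => by
      rw [← SetLike.mem_coe, ← hS, ← hd.2.1]
      exact Submodule.subset_span ⟨i, rfl⟩)
  have hone : p * s - q * r = 1 := by
    refine eq_one_of_sq_eq_one_of_pos hdet h0.2.2 hd.2.2 ?_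
    rw [hp, hr, ← det3_smul_add_smul]
    congr 1 <;> simp only [WithLp.add_fst, WithLp.add_snd, WithLp.smul_fst, WithLp.smul_snd] <;>
      module
  rw [invariantForm_one, invariantForm_two, normalTorus_snd,
    (frameForm_directFrame b _ _ hb _ _).1, (frameForm_directFrame b _ _ hb _ _).2, hp, hr]
  have e0 : inner ℝ (sphericalDeriv b x.1 x.2) (angular b x.1) = (0 : ℝ) := by
    rw [real_inner_comm, inner_angular_sphericalDeriv]
  simp only [frameForm₁, frameForm₂, torusFrame, WithLp.add_fst, WithLp.add_snd, WithLp.smul_fst,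
    WithLp.smul_snd, Matrix.cons_val_zero, Matrix.cons_val_one, inner_add_right, inner_smul_right,
    inner_angular_self, inner_sphericalDeriv_self, inner_angular_sphericalDeriv, e0,
    inner_zero_right, WithLp.toLp_fst, WithLp.toLp_snd]
  constructor
  · linear_combination (ρ / torusJac ρ x) * hone
  · linear_combination (Real.cos x.2 / torusJac ρ x) * hone

end

/-! ### Normal vectors of balls and lenses -/

/-- A direction making an obtuse angle with the radius vector does not leave the ball at first
order. Such entering directions are the test vectors for normals. -/
theorem eventually_add_smul_mem_closedBall {A p w : E3} {r : ℝ} (hp : ‖p - A‖ ≤ r)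
    (hw : inner ℝ (p - A) w < 0) :
    ∀ᶠ t in 𝓝[>] (0 : ℝ), p + t • w ∈ Metric.closedBall A r := by
  have hc : ∀ᶠ t in 𝓝 (0 : ℝ), 2 * inner ℝ (p - A) w + t * ‖w‖ ^ 2 < 0 := by
    have : ContinuousAt (fun t : ℝ => 2 * inner ℝ (p - A) w + t * ‖w‖ ^ 2) 0 := by fun_prop
    refine this.eventually (gt_mem_nhds ?_)
    linarith
  filter_upwards [nhdsWithin_le_nhds hc, self_mem_nhdsWithin] with t ht ht0
  have ht0 : 0 < t := ht0
  rw [mem_closedBall_iff_norm, show p + t • w - A = (p - A) + t • w by abel]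
  refine le_trans (le_of_sq_le_sq ?_ (norm_nonneg _)) hp
  rw [norm_add_sq_real, inner_smul_right, norm_smul, mul_pow, Real.norm_eq_abs, sq_abs]
  nlinarith

theorem eventually_add_smul_mem_closedBall_of_mem_ball {A p : E3} (w : E3) {r : ℝ}
    (hp : p ∈ Metric.ball A r) :
    ∀ᶠ t in 𝓝[>] (0 : ℝ), p + t • w ∈ Metric.closedBall A r := by
  have hc : ContinuousAt (fun t : ℝ => p + t • w) 0 := by fun_prop
  have := hc.eventually (Metric.isOpen_ball.mem_nhds (show p + (0 : ℝ) • w ∈ _ by simpa using hp))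
  filter_upwards [nhdsWithin_le_nhds this] with t ht
  exact Metric.ball_subset_closedBall ht

theorem inner_nonpos_of_eventually_mem {K : Set E3} {p n w : E3}
    (hn : ∀ y ∈ K, inner ℝ n (y - p) ≤ 0) (hw : ∀ᶠ t in 𝓝[>] (0 : ℝ), p + t • w ∈ K) :
    inner ℝ n w ≤ 0 := by
  obtain ⟨t, ht, ht0⟩ := (hw.and self_mem_nhdsWithin).exists
  have ht0 : 0 < t := ht0
  have := hn _ ht
  rw [add_sub_cancel_left, inner_smul_right] at this
  nlinarith

theorem le_of_forall_pos_le_add_mul {a b c : ℝ} (h : ∀ ε : ℝ, 0 < ε → a ≤ b + ε * c) : a ≤ b := by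
  have ht : Tendsto (fun ε : ℝ => b + ε * c) (𝓝[>] 0) (𝓝 (b + 0 * c)) :=
    (Continuous.tendsto (by fun_prop) 0).mono_left nhdsWithin_le_nhds
  rw [zero_mul, add_zero] at ht
  exact ge_of_tendsto ht (eventually_nhdsWithin_of_forall fun ε hε => h ε hε)

/-- The only outer unit normal vector at a point where a convex set is bounded by a sphere. -/
theorem smul_eq_sub_of_normal {A p n : E3} {r : ℝ} (hr : 0 < r) (hp : ‖p - A‖ = r) (hn : ‖n‖ = 1)
    (h : ∀ w, inner ℝ (p - A) w < 0 → inner ℝ n w ≤ 0) : r • n = p - A := by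
  set ν := p - A
  have hν : inner ℝ ν ν = r ^ 2 := by rw [real_inner_self_eq_norm_sq, hp]
  have hnn : inner ℝ n n = (1 : ℝ) := by rw [real_inner_self_eq_norm_sq, hn, one_pow]
  have hk0 : 0 ≤ inner ℝ n ν := by
    have := h (-ν) (by rw [inner_neg_right, hν]; nlinarith)
    rw [inner_neg_right] at this
    linarith
  have h1 : r ^ 2 ≤ inner ℝ n ν ^ 2 := by
    refine le_of_forall_pos_le_add_mul (c := inner ℝ n ν) fun ε hε => ?_
    -- The test vector is `n` with its `ν`-component removed (scaled by `r²`), pushed inward by `ε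
    -- ν`: its product with `ν` is `-ε r²`.
    have := h (r ^ 2 • n - (inner ℝ n ν + ε) • ν) (by
      rw [inner_sub_right, inner_smul_right, inner_smul_right, hν, real_inner_comm]
      nlinarith [pow_pos hr 2])
    rw [inner_sub_right, inner_smul_right, inner_smul_right, hnn] at this
    linarith
  have h2 : r ≤ inner ℝ n ν := le_of_sq_le_sq h1 hk0
  -- Equality case of Cauchy–Schwarz: `⟨n, ν⟩ ≥ r = ‖n‖ ‖ν‖`.
  have h3 : ‖r • n - ν‖ ^ 2 ≤ 0 := by
    rw [norm_sub_sq_real, norm_smul, hn, hp, inner_smul_left, Real.norm_eq_abs, abs_of_pos hr]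
    simp only [RCLike.conj_to_real]
    nlinarith
  have h4 : ‖r • n - ν‖ = 0 := by
    have := sq_nonneg ‖r • n - ν‖
    exact pow_eq_zero_iff (two_ne_zero) |>.1 (le_antisymm h3 this)
  exact sub_eq_zero.1 (norm_eq_zero.1 h4)

section

variable (b : OrthonormalBasis (Fin 3) ℝ E3) {r α : ℝ}

/-- The unit vectors of the normal cone of a lens at an edge point of longitude `θ`. -/
theorem exists_spherical_of_normal (hr : 0 < r) (hα0 : 0 < α) (hα : α < Real.pi / 2) (θ : ℝ)
    {n : E3} (hn : ‖n‖ = 1)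
    (h : ∀ w, inner ℝ ((r * Real.cos α) • radial b θ + (r * Real.sin α) • b 2) w < 0 →
      inner ℝ ((r * Real.cos α) • radial b θ - (r * Real.sin α) • b 2) w < 0 → inner ℝ n w ≤ 0) :
    ∃ φ ∈ Icc (-α) α, n = spherical b θ φ := by
  have hs : 0 < Real.sin α := Real.sin_pos_of_pos_of_lt_pi hα0 (by linarith [Real.pi_pos])
  have hc : 0 < Real.cos α := Real.cos_pos_of_mem_Ioo ⟨by linarith, hα⟩
  have d := decomp_spherical b θ 0 n
  have e1 : sphericalDeriv b θ 0 = b 2 := by simp [sphericalDeriv]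
  have e2 : spherical b θ 0 = radial b θ := by simp [spherical]
  rw [e1, e2] at d
  have r1 : inner ℝ (radial b θ) (radial b θ) = (1 : ℝ) := by
    rw [← e2]; exact inner_spherical_self b θ 0
  have r2 : inner ℝ (radial b θ) (angular b θ) = (0 : ℝ) := by
    rw [real_inner_comm, ← e2]; exact inner_angular_spherical b θ 0
  have r3 : inner ℝ (radial b θ) (b 2) = (0 : ℝ) := by
    rw [real_inner_comm]; exact inner_radial_two b θ
  have r4 : inner ℝ (angular b θ) (b 2) = (0 : ℝ) := by
    rw [real_inner_comm]; exact inner_angular_two b θ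
  have r5 : inner ℝ (b 2) (b 2) = (1 : ℝ) := by simp
  set a := inner ℝ (radial b θ) n with ha
  set β := inner ℝ (angular b θ) n with hβ
  set c := inner ℝ (b 2) n with hcd
  have hnorm : a ^ 2 + β ^ 2 + c ^ 2 = 1 := by
    have : inner ℝ n n = (1 : ℝ) := by rw [real_inner_self_eq_norm_sq, hn, one_pow]
    nth_rewrite 1 [d] at this
    rw [inner_add_left, inner_add_left, inner_smul_left, inner_smul_left, inner_smul_left] at this
    simp only [RCLike.conj_to_real] at this
    linarith
  have key : ∀ x y z : ℝ, Real.cos α * x + Real.sin α * z < 0 →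
      Real.cos α * x - Real.sin α * z < 0 → a * x + β * y + c * z ≤ 0 := by
    intro x y z h1 h2
    have := h (x • radial b θ + y • angular b θ + z • b 2) (by
      simp only [inner_add_left, inner_add_right, inner_smul_left, inner_smul_right, r1, r2, r3,
        RCLike.conj_to_real, inner_radial_two, inner_angular_two, r5]
      nlinarith) (by
      simp only [inner_sub_left, inner_add_right, inner_smul_left, inner_smul_right, r1, r2, r3,
        RCLike.conj_to_real, inner_radial_two, inner_angular_two, r5]
      nlinarith)
    simp only [inner_add_right, inner_smul_right] at this
    rw [real_inner_comm, ← ha, real_inner_comm (angular b θ) n, ← hβ, real_inner_comm (b 2) n,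
      ← hcd] at this
    linarith
  have hβ0 : β = 0 := by
    by_contra hne
    -- The direction `-radial` enters both balls, and adding any multiple of `angular` keeps it so;
    -- this multiple makes the product with `n` equal to `1`.
    have := key (-1) ((a + 1) / β) 0 (by linarith) (by linarith)
    rw [mul_div_cancel₀ _ hne] at this
    linarith
  -- At `ε = 0` the test vector is tangent to one of the two spheres. This inequality and the next
  -- say that the latitude of `n` lies in `[-α, α]`.
  have k1 : c * Real.cos α ≤ a * Real.sin α := by
    refine le_of_forall_pos_le_add_mul (c := a) fun ε hε => ?_
    have := key (-(Real.sin α + ε)) 0 (Real.cos α) (by nlinarith) (by nlinarith)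
    linarith
  have k2 : -c * Real.cos α ≤ a * Real.sin α := by
    refine le_of_forall_pos_le_add_mul (c := a) fun ε hε => ?_
    have := key (-(Real.sin α + ε)) 0 (-Real.cos α) (by nlinarith) (by nlinarith)
    linarith
  have ha0 : 0 ≤ a := by
    by_contra hneg
    push Not at hneg
    nlinarith
  rw [hβ0] at hnorm d
  have hc1 : -1 ≤ c := by nlinarith
  have hc2 : c ≤ 1 := by nlinarith
  have hsin : Real.sin (Real.arcsin c) = c := Real.sin_arcsin hc1 hc2
  have hcos : Real.cos (Real.arcsin c) = a := by
    rw [Real.cos_arcsin, show 1 - c ^ 2 = a ^ 2 by linarith, Real.sqrt_sq ha0]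
  have b1 := Real.neg_pi_div_two_le_arcsin c
  have b2 := Real.arcsin_le_pi_div_two c
  refine ⟨Real.arcsin c, ⟨?_, ?_⟩, ?_⟩
  · by_contra hlt
    push Not at hlt
    have := Real.sin_neg_of_neg_of_neg_pi_lt (x := α + Real.arcsin c) (by linarith) (by linarith)
    rw [Real.sin_add, hsin, hcos] at this
    linarith
  · by_contra hlt
    push Not at hlt
    have := Real.sin_neg_of_neg_of_neg_pi_lt (x := α - Real.arcsin c) (by linarith) (by linarith)
    rw [Real.sin_sub, hsin, hcos] at this
    linarith
  · rw [spherical, hsin, hcos]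
    rw [zero_smul, zero_add] at d
    rw [add_comm]
    exact d

theorem inner_sub_nonpos_of_mem_closedBall {A p y : E3} (hp : ‖p - A‖ = r)
    (hy : y ∈ Metric.closedBall A r) : inner ℝ (p - A) (y - p) ≤ 0 := by
  rw [mem_closedBall_iff_norm, show y - A = (p - A) + (y - p) by abel] at hy
  have h : ‖p - A + (y - p)‖ ^ 2 ≤ r ^ 2 := by gcongr
  rw [norm_add_sq_real, hp] at h
  nlinarith [sq_nonneg ‖y - p‖]

/-- The normal of latitude `φ` is a nonnegative combination of the two extreme ones: `sin 2α · ξ(φ)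
= sin (α + φ) · ξ(α) + sin (α − φ) · ξ(−α)`. -/
theorem inner_spherical_nonpos (hr : 0 < r) (hα0 : 0 < α) (hα : α < Real.pi / 2) (θ : ℝ) {φ : ℝ}
    (hφ : φ ∈ Icc (-α) α) {w : E3}
    (h1 : inner ℝ ((r * Real.cos α) • radial b θ + (r * Real.sin α) • b 2) w ≤ 0)
    (h2 : inner ℝ ((r * Real.cos α) • radial b θ - (r * Real.sin α) • b 2) w ≤ 0) :
    inner ℝ (spherical b θ φ) w ≤ 0 := by
  have hs : 0 < Real.sin α := Real.sin_pos_of_pos_of_lt_pi hα0 (by linarith [Real.pi_pos])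
  have hc : 0 < Real.cos α := Real.cos_pos_of_mem_Ioo ⟨by linarith, hα⟩
  have s1 : 0 ≤ Real.sin (α + φ) :=
    Real.sin_nonneg_of_nonneg_of_le_pi (by linarith [hφ.1]) (by linarith [hφ.2])
  have s2 : 0 ≤ Real.sin (α - φ) :=
    Real.sin_nonneg_of_nonneg_of_le_pi (by linarith [hφ.2]) (by linarith [hφ.1])
  rw [Real.sin_add] at s1
  rw [Real.sin_sub] at s2
  simp only [inner_add_left, inner_sub_left, inner_smul_left, RCLike.conj_to_real,
    spherical] at h1 h2 ⊢
  set a := inner ℝ (radial b θ) w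
  set c := inner ℝ (b 2) w
  have e1 : Real.cos α * a + Real.sin α * c ≤ 0 := by nlinarith
  have e2 : Real.cos α * a - Real.sin α * c ≤ 0 := by nlinarith
  have m1 := mul_nonpos_of_nonneg_of_nonpos s1 e1
  have m2 := mul_nonpos_of_nonneg_of_nonpos s2 e2
  have hpos : 0 < Real.sin α * Real.cos α := by positivity
  by_contra hneg
  push Not at hneg
  nlinarith [mul_pos hpos hneg]

variable (O : E3)

theorem norm_circle_sub_center (θ h : ℝ) (hr : 0 < r) (hh : h ^ 2 = (r * Real.sin α) ^ 2) :
    ‖(r * Real.cos α) • radial b θ + h • b 2‖ = r := by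
  have h1 := Real.sin_sq_add_cos_sq θ
  have h2 := Real.sin_sq_add_cos_sq α
  have : ‖(r * Real.cos α) • radial b θ + h • b 2‖ ^ 2 = r ^ 2 := by
    rw [norm_sq_eq_coords b]
    simp only [inner_add_right, inner_smul_right, inner_radial_zero, inner_radial_one,
      inner_radial_two, inner_basis]
    simp
    linear_combination hh + (r * Real.cos α) ^ 2 * h1 + r ^ 2 * h2
  exact (pow_left_inj₀ (norm_nonneg _) hr.le two_ne_zero).1 this

/-- Subtracting the equations of the two spheres kills the axial coordinate; the other two form a
complex number of modulus `r cos α`, whose argument is the longitude. -/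
theorem exists_eq_circle (hr : 0 < r) (hα0 : 0 < α) (hα : α < Real.pi / 2) {y : E3}
    (h1 : ‖y - (O - (r * Real.sin α) • b 2)‖ = r) (h2 : ‖y - (O + (r * Real.sin α) • b 2)‖ = r) :
    ∃ θ ∈ Ioc (-Real.pi) Real.pi, y = O + (r * Real.cos α) • radial b θ := by
  have hs : 0 < Real.sin α := Real.sin_pos_of_pos_of_lt_pi hα0 (by linarith [Real.pi_pos])
  have hc : 0 < Real.cos α := Real.cos_pos_of_mem_Ioo ⟨by linarith, hα⟩
  have q1 : ‖(y - O) + (r * Real.sin α) • b 2‖ ^ 2 = r ^ 2 := by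
    rw [show y - O + (r * Real.sin α) • b 2 = y - (O - (r * Real.sin α) • b 2) by abel, h1]
  have q2 : ‖(y - O) - (r * Real.sin α) • b 2‖ ^ 2 = r ^ 2 := by
    rw [show y - O - (r * Real.sin α) • b 2 = y - (O + (r * Real.sin α) • b 2) by abel, h2]
  rw [norm_sq_eq_coords b] at q1 q2
  simp only [inner_add_right (_ : E3) (y - O), inner_sub_right (_ : E3) (y - O),
    inner_smul_right, inner_basis] at q1 q2
  set y0 := inner ℝ (b 0) (y - O) with hy0
  set y1 := inner ℝ (b 1) (y - O) with hy1
  set y2 := inner ℝ (b 2) (y - O) with hy2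
  simp at q1 q2
  have hz : y2 = 0 := by
    have : r * Real.sin α * y2 = 0 := by linarith
    rcases mul_eq_zero.1 this with h | h
    · exact absurd h (by positivity)
    · exact h
  have hρ : y0 ^ 2 + y1 ^ 2 = (r * Real.cos α) ^ 2 := by
    have := Real.sin_sq_add_cos_sq α
    rw [hz] at q1
    linear_combination q1 - r ^ 2 * this
  set z : ℂ := ⟨y0, y1⟩ with hzdef
  have hzn : ‖z‖ = r * Real.cos α := by
    rw [← Real.sqrt_sq (show 0 ≤ r * Real.cos α by positivity), ← hρ, Complex.norm_eq_sqrt_sq_add_sq]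
  have hz0 : z ≠ 0 := by
    rw [← norm_pos_iff, hzn]
    positivity
  have hne : r * Real.cos α ≠ 0 := by positivity
  have ec : r * Real.cos α * Real.cos z.arg = y0 := by
    rw [Complex.cos_arg hz0, hzn, mul_div_cancel₀ _ hne]
  have es : r * Real.cos α * Real.sin z.arg = y1 := by
    rw [Complex.sin_arg, hzn, mul_div_cancel₀ _ hne]
  refine ⟨z.arg, Complex.arg_mem_Ioc z, ?_⟩
  rw [← sub_eq_iff_eq_add']
  apply ext_coords b
  · rw [inner_smul_right, inner_radial_zero, ec]
  · rw [inner_smul_right, inner_radial_one, es]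
  · rw [inner_smul_right, inner_radial_two, mul_zero, ← hy2, hz]

end

/-! ### The unit normal bundle of a lens -/

/-- The intersection of two balls of radius `r`, centred on the axis of `b` through `O`, whose
spheres meet along a circle seen from each centre at the angle `α` from the plane of the circle. -/
def lens (O : E3) (b : OrthonormalBasis (Fin 3) ℝ E3) (r α : ℝ) : Set E3 :=
  Metric.closedBall (O - (r * Real.sin α) • b 2) r ∩
    Metric.closedBall (O + (r * Real.sin α) • b 2) r

section

variable (O : E3) (b : OrthonormalBasis (Fin 3) ℝ E3) {r α : ℝ}

theorem circle_sub_left (θ : ℝ) :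
    O + (r * Real.cos α) • radial b θ - (O - (r * Real.sin α) • b 2) =
      (r * Real.cos α) • radial b θ + (r * Real.sin α) • b 2 := by
  abel

theorem circle_sub_right (θ : ℝ) :
    O + (r * Real.cos α) • radial b θ - (O + (r * Real.sin α) • b 2) =
      (r * Real.cos α) • radial b θ - (r * Real.sin α) • b 2 := by
  abel

theorem norm_circle_sub_left (hr : 0 < r) (θ : ℝ) :
    ‖O + (r * Real.cos α) • radial b θ - (O - (r * Real.sin α) • b 2)‖ = r := by
  rw [circle_sub_left]
  exact norm_circle_sub_center b θ _ hr rfl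

theorem norm_circle_sub_right (hr : 0 < r) (θ : ℝ) :
    ‖O + (r * Real.cos α) • radial b θ - (O + (r * Real.sin α) • b 2)‖ = r := by
  rw [circle_sub_right, sub_eq_add_neg, ← neg_smul]
  exact norm_circle_sub_center b θ _ hr (by ring)

theorem norm_spherical (θ φ : ℝ) : ‖spherical b θ φ‖ = 1 := by
  have := inner_spherical_self b θ φ
  rw [real_inner_self_eq_norm_sq] at this
  exact (pow_left_inj₀ (norm_nonneg _) zero_le_one two_ne_zero).1 (by rw [this, one_pow])

theorem frontier_lens_subset (hr : 0 < r) {y : E3} (hy : y ∈ frontier (lens O b r α)) :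
    (‖y - (O - (r * Real.sin α) • b 2)‖ ≤ r ∧ ‖y - (O + (r * Real.sin α) • b 2)‖ ≤ r) ∧
      (‖y - (O - (r * Real.sin α) • b 2)‖ = r ∨ ‖y - (O + (r * Real.sin α) • b 2)‖ = r) := by
  have hcl : IsClosed (lens O b r α) := Metric.isClosed_closedBall.inter Metric.isClosed_closedBall
  rw [hcl.frontier_eq, lens, interior_inter, interior_closedBall _ hr.ne',
    interior_closedBall _ hr.ne'] at hy
  obtain ⟨⟨h1, h2⟩, h3⟩ := hy
  rw [mem_closedBall_iff_norm] at h1 h2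
  refine ⟨⟨h1, h2⟩, ?_⟩
  by_contra hne
  push Not at hne
  exact h3 ⟨mem_ball_iff_norm.2 (lt_of_le_of_ne h1 hne.1),
    mem_ball_iff_norm.2 (lt_of_le_of_ne h2 hne.2)⟩

theorem normalTorus_mem_normalBundle_lens (hr : 0 < r) (hα0 : 0 < α) (hα : α < Real.pi / 2)
    {x : ℝ × ℝ} (hx : x.2 ∈ Icc (-α) α) :
    normalTorus O (r * Real.cos α) b x ∈ normalBundle (lens O b r α) := by
  have n1 := norm_circle_sub_left O b (α := α) hr x.1
  have n2 := norm_circle_sub_right O b (α := α) hr x.1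
  refine ⟨?_, norm_spherical b _ _, ?_⟩
  · have hcl : IsClosed (lens O b r α) :=
      Metric.isClosed_closedBall.inter Metric.isClosed_closedBall
    rw [hcl.frontier_eq]
    refine ⟨⟨mem_closedBall_iff_norm.2 n1.le, mem_closedBall_iff_norm.2 n2.le⟩, fun hi => ?_⟩
    rw [lens, interior_inter, interior_closedBall _ hr.ne'] at hi
    have := mem_ball_iff_norm.1 hi.1
    rw [normalTorus_fst, n1] at this
    exact lt_irrefl _ this
  · intro y hy
    refine inner_spherical_nonpos b hr hα0 hα x.1 hx ?_ ?_
    · have := inner_sub_nonpos_of_mem_closedBall n1 hy.1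
      rwa [circle_sub_left] at this
    · have := inner_sub_nonpos_of_mem_closedBall n2 hy.2
      rwa [circle_sub_right] at this

theorem exists_eq_normalTorus (hr : 0 < r) (hα0 : 0 < α) (hα : α < Real.pi / 2) {q : TE3}
    (hq : q ∈ normalBundle (lens O b r α))
    (h1 : ‖q.fst - (O - (r * Real.sin α) • b 2)‖ = r)
    (h2 : ‖q.fst - (O + (r * Real.sin α) • b 2)‖ = r) :
    ∃ x ∈ Ioc (-Real.pi) Real.pi ×ˢ Icc (-α) α, q = normalTorus O (r * Real.cos α) b x := by
  obtain ⟨θ, hθ, hqθ⟩ := exists_eq_circle b O hr hα0 hα h1 h2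
  obtain ⟨φ, hφ, hqφ⟩ := exists_spherical_of_normal b hr hα0 hα θ hq.2.1 (by
    intro w hw1 hw2
    refine inner_nonpos_of_eventually_mem hq.2.2 ?_
    have e1 := eventually_add_smul_mem_closedBall h1.le
      (by rwa [hqθ, circle_sub_left])
    have e2 := eventually_add_smul_mem_closedBall h2.le
      (by rwa [hqθ, circle_sub_right])
    filter_upwards [e1, e2] with t ht1 ht2 using ⟨ht1, ht2⟩)
  refine ⟨(θ, φ), ⟨hθ, hφ⟩, ?_⟩
  apply WithLp.ofLp_injective 2
  exact Prod.ext hqθ hqφ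

theorem smul_snd_eq_of_mem_normalBundle_closedBall {A : E3} (hr : 0 < r) {q : TE3}
    (hq : q ∈ normalBundle (Metric.closedBall A r)) : r • q.snd = q.fst - A := by
  obtain ⟨hf, hn, h⟩ := hq
  rw [frontier_closedBall _ hr.ne', mem_sphere_iff_norm] at hf
  exact smul_eq_sub_of_normal hr hf hn fun w hw =>
    inner_nonpos_of_eventually_mem h (eventually_add_smul_mem_closedBall hf.le hw)

theorem smul_spherical_self (θ : ℝ) : r • spherical b θ α =
    (r * Real.cos α) • radial b θ + (r * Real.sin α) • b 2 := by
  rw [spherical]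
  module

theorem smul_spherical_neg (θ : ℝ) : r • spherical b θ (-α) =
    (r * Real.cos α) • radial b θ - (r * Real.sin α) • b 2 := by
  rw [spherical, Real.cos_neg, Real.sin_neg]
  module

theorem eq_normalTorus_of_smul_snd_left (hr : 0 < r) {q : TE3} {θ : ℝ}
    (hq : q.fst = O + (r * Real.cos α) • radial b θ)
    (h : r • q.snd = q.fst - (O - (r * Real.sin α) • b 2)) :
    q = normalTorus O (r * Real.cos α) b (θ, α) := by
  rw [hq, circle_sub_left, ← smul_spherical_self] at h
  apply WithLp.ofLp_injective 2
  exact Prod.ext hq (smul_right_injective E3 hr.ne' h)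

theorem eq_normalTorus_of_smul_snd_right (hr : 0 < r) {q : TE3} {θ : ℝ}
    (hq : q.fst = O + (r * Real.cos α) • radial b θ)
    (h : r • q.snd = q.fst - (O + (r * Real.sin α) • b 2)) :
    q = normalTorus O (r * Real.cos α) b (θ, -α) := by
  rw [hq, circle_sub_right, ← smul_spherical_neg] at h
  apply WithLp.ofLp_injective 2
  exact Prod.ext hq (smul_right_injective E3 hr.ne' h)

/-- Away from the edge circle, a boundary point lies on one sphere and inside the other ball, so its
normal is radial. Excluding both radial directions is an open condition that leaves only the torus.
-/
theorem mem_torus_of_mem_normalBundle_lens (hr : 0 < r) (hα0 : 0 < α) (hα : α < Real.pi / 2)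
    {q : TE3} (hq : q ∈ normalBundle (lens O b r α))
    (h1 : r • q.snd ≠ q.fst - (O - (r * Real.sin α) • b 2))
    (h2 : r • q.snd ≠ q.fst - (O + (r * Real.sin α) • b 2)) :
    ∃ x, q = normalTorus O (r * Real.cos α) b x := by
  obtain ⟨⟨l1, l2⟩, h3⟩ := frontier_lens_subset O b hr hq.1
  by_cases e1 : ‖q.fst - (O - (r * Real.sin α) • b 2)‖ = r
  · by_cases e2 : ‖q.fst - (O + (r * Real.sin α) • b 2)‖ = r
    · obtain ⟨x, -, hx⟩ := exists_eq_normalTorus O b hr hα0 hα hq e1 e2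
      exact ⟨x, hx⟩
    · refine absurd (smul_eq_sub_of_normal hr e1 hq.2.1 fun w hw => ?_) h1
      refine inner_nonpos_of_eventually_mem hq.2.2 ?_
      filter_upwards [eventually_add_smul_mem_closedBall l1 hw,
        eventually_add_smul_mem_closedBall_of_mem_ball w
          (mem_ball_iff_norm.2 (lt_of_le_of_ne l2 e2))] with t ht1 ht2 using ⟨ht1, ht2⟩
  · have e2 := h3.resolve_left e1
    refine absurd (smul_eq_sub_of_normal hr e2 hq.2.1 fun w hw => ?_) h2
    refine inner_nonpos_of_eventually_mem hq.2.2 ?_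
    filter_upwards [eventually_add_smul_mem_closedBall_of_mem_ball w
        (mem_ball_iff_norm.2 (lt_of_le_of_ne l1 e1)),
      eventually_add_smul_mem_closedBall l2 hw] with t ht1 ht2 using ⟨ht1, ht2⟩

/-! ### The tangent planes of the unit normal bundle of a lens -/

theorem hasDerivAt_radial_comp {f : ℝ → ℝ} {f' x : ℝ} (hf : HasDerivAt f f' x) :
    HasDerivAt (fun t => radial b (f t)) (f' • angular b (f x)) x := by
  refine ((hf.cos.smul_const (b 0)).add (hf.sin.smul_const (b 1))).congr_deriv ?_
  rw [angular]
  module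

theorem hasDerivAt_spherical_comp {f g : ℝ → ℝ} {f' g' x : ℝ} (hf : HasDerivAt f f' x)
    (hg : HasDerivAt g g' x) :
    HasDerivAt (fun t => spherical b (f t) (g t))
      ((f' * Real.cos (g x)) • angular b (f x) + g' • sphericalDeriv b (f x) (g x)) x := by
  refine ((hg.cos.smul (hasDerivAt_radial_comp b hf)).add
    (hg.sin.smul_const (b 2))).congr_deriv ?_
  rw [sphericalDeriv]
  module

theorem mem_tangentConeAt_of_hasDerivAt {V : Type*} [NormedAddCommGroup V] [NormedSpace ℝ V]
    {S : Set V} {γ : ℝ → V} {v : V} (h : HasDerivAt γ v 0) (hS : ∀ᶠ τ in 𝓝 0, γ τ ∈ S) :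
    v ∈ tangentConeAt ℝ S (γ 0) := by
  have h1 := (h.hasFDerivAt.hasFDerivWithinAt (s := {τ | γ τ ∈ S})).mapsTo_tangent_cone
  rw [tangentConeAt_of_mem_nhds hS] at h1
  have h2 := tangentConeAt_mono (𝕜 := ℝ) (x := γ 0) (show γ '' {τ | γ τ ∈ S} ⊆ S by
    rintro _ ⟨τ, hτ, rfl⟩
    exact hτ)
  have := h2 (h1 (mem_univ (1 : ℝ)))
  simpa using this

theorem hasDerivAt_toLp_prodMk {V W : Type*} [NormedAddCommGroup V] [NormedSpace ℝ V]
    [NormedAddCommGroup W] [NormedSpace ℝ W] {f : ℝ → V} {g : ℝ → W} {f' : V} {g' : W} {x : ℝ}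
    (hf : HasDerivAt f f' x) (hg : HasDerivAt g g' x) :
    HasDerivAt (fun t => WithLp.toLp 2 (f t, g t)) (WithLp.toLp 2 (f', g')) x :=
  ((WithLp.prodContinuousLinearEquiv 2 ℝ V W).symm.hasFDerivAt (x := (f x, g x))).comp_hasDerivAt x
    (hf.prodMk hg)

theorem toLp_mem_tangentConeAt {V W : Type*} [NormedAddCommGroup V] [NormedSpace ℝ V]
    [NormedAddCommGroup W] [NormedSpace ℝ W] {S : Set (WithLp 2 (V × W))} {f : ℝ → V} {g : ℝ → W}
    {f' : V} {g' : W} (hf : HasDerivAt f f' 0) (hg : HasDerivAt g g' 0)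
    (hS : ∀ᶠ τ in 𝓝 0, WithLp.toLp 2 (f τ, g τ) ∈ S) :
    WithLp.toLp 2 (f', g') ∈ tangentConeAt ℝ S (WithLp.toLp 2 (f 0, g 0)) :=
  mem_tangentConeAt_of_hasDerivAt (hasDerivAt_toLp_prodMk hf hg) hS

theorem toLp_mem_tangentConeAt_normalTorus (ρ : ℝ) (x : ℝ × ℝ) (s t : ℝ) {S : Set TE3}
    (hS : ∀ᶠ τ in 𝓝 (0 : ℝ), normalTorus O ρ b (x.1 + τ * s, x.2 + τ * t) ∈ S) :
    WithLp.toLp 2 ((ρ * s) • angular b x.1,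
        (s * Real.cos x.2) • angular b x.1 + t • sphericalDeriv b x.1 x.2) ∈
      tangentConeAt ℝ S (normalTorus O ρ b x) := by
  have l : ∀ u v : ℝ, HasDerivAt (fun τ : ℝ => u + τ * v) v 0 := by
    intro u v
    simpa using ((hasDerivAt_id (0 : ℝ)).mul_const v).const_add u
  have z : ∀ u v : ℝ, u + 0 * v = u := by intro u v; ring
  have hr := ((hasDerivAt_radial_comp b (l x.1 s)).const_smul ρ).const_add O
  have hs := hasDerivAt_spherical_comp b (l x.1 s) (l x.2 t)
  simp only [z, smul_smul] at hr hs
  have := toLp_mem_tangentConeAt hr hs hS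
  simp only [Pi.smul_apply, z] at this
  exact this

/-- The derivative maps the tangent cone of `S` into the tangent cone of `{0}`, which is trivial. -/
theorem fderiv_eq_zero_of_mem_tangentConeAt {V : Type*} [NormedAddCommGroup V] [NormedSpace ℝ V]
    {S : Set V} {p v : V} {G : V → ℝ} {G' : V →L[ℝ] ℝ} (hG : HasFDerivAt G G' p)
    (h0 : ∀ᶠ q in 𝓝 p, q ∈ S → G q = 0) (hv : v ∈ tangentConeAt ℝ S p) : G' v = 0 := by
  rw [← tangentConeAt_inter_nhds h0] at hv
  have h1 := (hG.hasFDerivWithinAt (s := S ∩ {q | q ∈ S → G q = 0})).mapsTo_tangent_cone hv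
  have h2 : G '' (S ∩ {q | q ∈ S → G q = 0}) ⊆ {0} := by
    rintro _ ⟨q, ⟨hq, hq'⟩, rfl⟩
    exact hq' hq
  have h3 := tangentConeAt_mono (𝕜 := ℝ) (x := G p) h2 h1
  exact tangentConeAt_subset_zero
    (fun hacc => Set.Infinite.of_accPt hacc (Set.finite_singleton (0 : ℝ))) h3

end

section

variable (O : E3) (b : OrthonormalBasis (Fin 3) ℝ E3) {r α : ℝ}

/-- Four linear equations in dimension six. The last says that the base point and the normal turn
about the axis at the same rate. -/
theorem mem_span_torusFrame {ρ : ℝ} (hρ : 0 < ρ) (x : ℝ × ℝ) {v : TE3}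
    (h1 : inner ℝ (b 2) v.fst = 0) (h2 : inner ℝ (radial b x.1) v.fst = 0)
    (h3 : inner ℝ (spherical b x.1 x.2) v.snd = 0)
    (h4 : ρ * inner ℝ (angular b x.1) v.snd = Real.cos x.2 * inner ℝ (angular b x.1) v.fst) :
    v ∈ Submodule.span ℝ (Set.range (torusFrame ρ b x)) := by
  have hJ0 := (torusJac_pos hρ x).ne'
  have d1 := decomp_spherical b x.1 0 v.fst
  have e1 : sphericalDeriv b x.1 0 = b 2 := by simp [sphericalDeriv]
  have e2 : spherical b x.1 0 = radial b x.1 := by simp [spherical]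
  rw [e1, e2, h1, h2, zero_smul, zero_smul, add_zero, add_zero] at d1
  have d2 := decomp_spherical b x.1 x.2 v.snd
  rw [h3, zero_smul, add_zero] at d2
  set s := inner ℝ (angular b x.1) v.fst
  set t := inner ℝ (sphericalDeriv b x.1 x.2) v.snd
  have h4' : inner ℝ (angular b x.1) v.snd = s / ρ * Real.cos x.2 := by
    field_simp
    linarith
  rw [h4'] at d2
  have hv : v = (torusJac ρ x * (s / ρ)) • torusFrame ρ b x 0 + t • torusFrame ρ b x 1 := by
    apply WithLp.ofLp_injective 2
    refine Prod.ext ?_ ?_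
    · change v.fst = ((torusJac ρ x * (s / ρ)) • torusFrame ρ b x 0 + t • torusFrame ρ b x 1).fst
      conv_lhs => rw [d1]
      simp only [torusFrame, Matrix.cons_val_zero, Matrix.cons_val_one, WithLp.add_fst,
        WithLp.smul_fst, WithLp.toLp_fst, smul_smul, smul_zero, add_zero]
      congr 1
      field_simp
    · change v.snd = ((torusJac ρ x * (s / ρ)) • torusFrame ρ b x 0 + t • torusFrame ρ b x 1).snd
      conv_lhs => rw [d2]
      simp only [torusFrame, Matrix.cons_val_zero, Matrix.cons_val_one, WithLp.add_snd,
        WithLp.smul_snd, WithLp.toLp_snd, smul_smul]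
      congr 2
      field_simp
  rw [hv]
  exact add_mem (Submodule.smul_mem _ _ (Submodule.subset_span ⟨0, rfl⟩))
    (Submodule.smul_mem _ _ (Submodule.subset_span ⟨1, rfl⟩))

/-- Four functions vanish on the torus: the axial coordinate of `q.fst - O`, `‖q.fst - O‖² − ρ²`,
`‖q.snd‖² − 1`, and the planar cross product of the horizontal parts of `q.fst - O` and `q.snd`.
Their differentials are the equations of `mem_span_torusFrame`. -/
theorem tangentConeAt_subset_span_torusFrame {ρ : ℝ} (hρ : 0 < ρ) (x : ℝ × ℝ) {S : Set TE3}
    (hS : ∀ᶠ q in 𝓝 (normalTorus O ρ b x), q ∈ S → ∃ y, q = normalTorus O ρ b y) :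
    tangentConeAt ℝ S (normalTorus O ρ b x) ⊆
      Submodule.span ℝ (Set.range (torusFrame ρ b x)) := by
  intro v hv
  set p := normalTorus O ρ b x
  have hF : HasFDerivAt (fun q : TE3 => q.fst - O) (WithLp.fstL 2 ℝ E3 E3) p :=
    (WithLp.fstL 2 ℝ E3 E3).hasFDerivAt.sub_const O
  have hs : HasFDerivAt (fun q : TE3 => q.snd) (WithLp.sndL 2 ℝ E3 E3) p :=
    (WithLp.sndL 2 ℝ E3 E3).hasFDerivAt
  have c : ∀ i, HasFDerivAt (fun _ : TE3 => b i) (0 : TE3 →L[ℝ] E3) p := fun i =>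
    hasFDerivAt_const _ _
  have kill : ∀ {G : TE3 → ℝ} {G' : TE3 →L[ℝ] ℝ}, HasFDerivAt G G' p →
      (∀ y, G (normalTorus O ρ b y) = 0) → G' v = 0 := by
    intro G G' hG h0
    refine fderiv_eq_zero_of_mem_tangentConeAt hG ?_ hv
    filter_upwards [hS] with q hq hqS
    obtain ⟨y, rfl⟩ := hq hqS
    exact h0 y
  have pf : p.fst - O = ρ • radial b x.1 := by simp [p]
  have ps : p.snd = spherical b x.1 x.2 := rfl
  have k1 := kill ((c 2).inner ℝ hF) (fun y => by simp [inner_smul_right])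
  have k2 := kill ((hF.inner ℝ hF).sub_const (ρ ^ 2)) (fun y => by
    have := inner_spherical_self b y.1 0
    rw [show spherical b y.1 0 = radial b y.1 by simp [spherical]] at this
    simp only [normalTorus_fst, add_sub_cancel_left, inner_smul_left, inner_smul_right, this,
      RCLike.conj_to_real]
    ring)
  have k3 := kill ((hs.inner ℝ hs).sub_const 1) (fun y => by
    simp only [normalTorus_snd, inner_spherical_self, sub_self])
  have k4 := kill ((((c 0).inner ℝ hF).mul ((c 1).inner ℝ hs)).sub
    (((c 1).inner ℝ hF).mul ((c 0).inner ℝ hs))) (fun y => by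
      simp [inner_smul_right]
      ring)
  simp only [ContinuousLinearMap.comp_apply, ContinuousLinearMap.prod_apply, fderivInnerCLM_apply,
    WithLp.fstL_apply, WithLp.sndL_apply, zero_apply, inner_zero_left,
    add_zero, sub_apply, add_apply,
    smul_apply, smul_eq_mul, pf, ps, inner_smul_left, inner_smul_right,
    RCLike.conj_to_real, inner_radial_zero, inner_radial_one, inner_spherical_zero,
    inner_spherical_one] at k1 k2 k3 k4
  refine mem_span_torusFrame b hρ x (by simpa using k1) ?_ ?_ ?_
  · rw [real_inner_comm (radial b x.1) v.fst] at k2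
    have : ρ * inner ℝ (radial b x.1) v.fst = 0 := by linarith
    exact (mul_eq_zero.1 this).resolve_left hρ.ne'
  · rw [real_inner_comm (spherical b x.1 x.2) v.snd] at k3
    linarith
  · rw [inner_eq_coords b (angular b x.1) v.fst, inner_eq_coords b (angular b x.1) v.snd]
    simp only [inner_angular_zero, inner_angular_one, inner_angular_two]
    linear_combination k4

theorem span_torusFrame_subset_tangentConeAt (ρ : ℝ) (x : ℝ × ℝ) {S : Set TE3}
    (hS : ∀ᶠ y in 𝓝 x, normalTorus O ρ b y ∈ S) :
    (Submodule.span ℝ (Set.range (torusFrame ρ b x)) : Set TE3) ⊆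
      tangentConeAt ℝ S (normalTorus O ρ b x) := by
  intro v hv
  have hr : Set.range (torusFrame ρ b x) = {torusFrame ρ b x 0, torusFrame ρ b x 1} := by
    ext x
    simp [Fin.exists_fin_two, eq_comm]
  rw [SetLike.mem_coe, hr, Submodule.mem_span_pair] at hv
  obtain ⟨s, t, rfl⟩ := hv
  have hc : Tendsto (fun τ : ℝ => (x.1 + τ * ((torusJac ρ x)⁻¹ * s), x.2 + τ * t)) (𝓝 0)
      (𝓝 x) := by
    have : Continuous fun τ : ℝ => (x.1 + τ * ((torusJac ρ x)⁻¹ * s), x.2 + τ * t) := by fun_prop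
    simpa using this.tendsto 0
  have := toLp_mem_tangentConeAt_normalTorus O b ρ x ((torusJac ρ x)⁻¹ * s) t (hc.eventually hS)
  convert this using 1
  apply WithLp.ofLp_injective 2
  refine Prod.ext ?_ ?_
  · change (s • torusFrame ρ b x 0 + t • torusFrame ρ b x 1).fst = _
    simp only [torusFrame, Matrix.cons_val_zero, Matrix.cons_val_one, WithLp.add_fst,
      WithLp.smul_fst, WithLp.toLp_fst, smul_smul, smul_zero, add_zero]
    congr 1
    ring
  · change (s • torusFrame ρ b x 0 + t • torusFrame ρ b x 1).snd = _
    simp only [torusFrame, Matrix.cons_val_zero, Matrix.cons_val_one, WithLp.add_snd,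
      WithLp.smul_snd, WithLp.toLp_snd, smul_smul]
    congr 2
    ring

/-- Strictly between the extreme latitudes the normal is radial for neither ball, so near such a
point the bundle is contained in the torus; conversely it contains the torus points of nearby
parameters. -/
theorem tangentConeAt_normalBundle_lens (hr : 0 < r) (hα0 : 0 < α) (hα : α < Real.pi / 2)
    {x : ℝ × ℝ} (hx : x.2 ∈ Ioo (-α) α) :
    tangentConeAt ℝ (normalBundle (lens O b r α)) (normalTorus O (r * Real.cos α) b x) =
      Submodule.span ℝ (Set.range (torusFrame (r * Real.cos α) b x)) := by
  have hρ : 0 < r * Real.cos α := mul_pos hr (Real.cos_pos_of_mem_Ioo ⟨by linarith, hα⟩)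
  have hsin : ∀ u, r • spherical b x.1 x.2 =
      (r * Real.cos α) • radial b x.1 + u • b 2 → r * Real.sin x.2 = u := by
    intro u h
    have := congrArg (fun y : E3 => inner ℝ (b 2) y) h
    simpa [inner_add_right, inner_smul_right] using this
  have hmono : ∀ u v : ℝ, -(Real.pi / 2) ≤ u → u < v → v ≤ Real.pi / 2 →
      r * Real.sin u < r * Real.sin v := fun u v h1 h2 h3 =>
    mul_lt_mul_of_pos_left (Real.sin_lt_sin_of_lt_of_le_pi_div_two h1 h3 h2) hr
  apply Subset.antisymm
  · refine tangentConeAt_subset_span_torusFrame O b hρ x ?_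
    have cf : Continuous fun q : TE3 => q.fst := (WithLp.fstL 2 ℝ E3 E3).continuous
    have cs : Continuous fun q : TE3 => q.snd := (WithLp.sndL 2 ℝ E3 E3).continuous
    have o1 : ∀ A : E3, IsOpen {q : TE3 | r • q.snd ≠ q.fst - A} := fun A =>
      isOpen_ne_fun (cs.const_smul r) (cf.sub continuous_const)
    have m1 : normalTorus O (r * Real.cos α) b x ∈
        {q : TE3 | r • q.snd ≠ q.fst - (O - (r * Real.sin α) • b 2)} := by
      intro h
      rw [normalTorus_fst, normalTorus_snd, circle_sub_left] at h
      exact (hmono _ _ (by linarith [hx.1]) hx.2 hα.le).ne (hsin _ h)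
    have m2 : normalTorus O (r * Real.cos α) b x ∈
        {q : TE3 | r • q.snd ≠ q.fst - (O + (r * Real.sin α) • b 2)} := by
      intro h
      rw [normalTorus_fst, normalTorus_snd, circle_sub_right, sub_eq_add_neg, ← neg_smul] at h
      have h1 := hmono _ _ (by linarith) hx.1 (by linarith [hx.2])
      rw [hsin _ h, Real.sin_neg] at h1
      linarith
    filter_upwards [(o1 _).mem_nhds m1, (o1 _).mem_nhds m2] with q h1 h2 hq
    exact mem_torus_of_mem_normalBundle_lens O b hr hα0 hα hq h1 h2
  · refine span_torusFrame_subset_tangentConeAt O b _ x ?_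
    have : ∀ᶠ y : ℝ × ℝ in 𝓝 x, y.2 ∈ Ioo (-α) α :=
      continuous_snd.continuousAt.eventually (isOpen_Ioo.mem_nhds hx)
    filter_upwards [this] with y hy
    exact normalTorus_mem_normalBundle_lens O b hr hα0 hα (Ioo_subset_Icc_self hy)

end

/-! ### Integration over the unit normal bundle of a lens -/

theorem measurable_fst_TE3 : Measurable fun q : TE3 => q.fst :=
  (WithLp.fstL 2 ℝ E3 E3).continuous.measurable

theorem measurable_snd_TE3 : Measurable fun q : TE3 => q.snd :=
  (WithLp.sndL 2 ℝ E3 E3).continuous.measurable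

theorem curvatureMeasure_normalCycle (K : Set E3) (k : ℕ) {D : Set E3} (hD : MeasurableSet D) :
    curvatureMeasure (normalCycle K) k D =
      ∫ p in normalBundle K ∩ {p | p.fst ∈ D},
        invariantForm k p (positiveTangentFrame (normalBundle K) p) ∂μHE[2] := by
  have hm : MeasurableSet {p : TE3 | p.fst ∈ D} := measurable_fst_TE3 hD
  rw [curvatureMeasure, TwoCurrent.restrict, normalCycle, currentOfOrientedSet,
    ← setIntegral_indicator hm]
  refine integral_congr_ae (.of_forall fun p => ?_)
  by_cases hp : p ∈ {p : TE3 | p.fst ∈ D}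
  · simp only [indicator_of_mem hp]
  · simp only [indicator_of_notMem hp]
    rfl

theorem curvatureMeasure_unionNormalCycle_pair (K₁ K₂ : Set E3) (k : ℕ) (D : Set E3) :
    curvatureMeasure (unionNormalCycle ![K₁, K₂]) k D =
      curvatureMeasure (normalCycle K₁) k D + curvatureMeasure (normalCycle K₂) k D -
        curvatureMeasure (normalCycle (K₁ ∩ K₂)) k D := by
  have hs : (Finset.univ.filter fun s : Finset (Fin 2) => s.Nonempty) = {{0}, {1}, {0, 1}} := by
    decide
  simp only [curvatureMeasure, TwoCurrent.restrict, unionNormalCycle, Finset.sum_apply,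
    Pi.smul_apply, smul_eq_mul]
  rw [hs, Finset.sum_insert (by decide), Finset.sum_insert (by decide), Finset.sum_singleton]
  simp
  ring

section

variable (O : E3) (b : OrthonormalBasis (Fin 3) ℝ E3) {r α : ℝ}

/-- Disposes both of the edges of the lens piece and of the part of each ball's bundle lying over
the circle. -/
theorem euclideanHausdorffMeasure_normalTorus_of_latitudes {ρ : ℝ} (hρ : 0 < ρ)
    (hα : α < Real.pi / 2) {Θ t : Set ℝ} (hΘ : Θ ⊆ Ioc (-Real.pi) Real.pi)
    (hΘm : MeasurableSet Θ) (ht : t ⊆ Icc (-α) α) (ht0 : t.Finite) :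
    μHE[2] (normalTorus O ρ b '' (Θ ×ˢ t)) = 0 := by
  rw [euclideanHausdorffMeasure_normalTorus O hρ b hα (prod_mono hΘ ht)
    (hΘm.prod ht0.measurableSet)]
  refine setLIntegral_measure_zero _ _ ?_
  rw [Measure.volume_eq_prod, Measure.prod_prod, ht0.measure_zero, mul_zero]

/-- The Jacobian cancels the denominator of the integrand, and Fubini separates longitude from
latitude. -/
theorem setIntegral_normalTorus_image_of_eq {ρ : ℝ} (hρ : 0 < ρ) (hα : α < Real.pi / 2)
    {Θ : Set ℝ} (hΘ : Θ ⊆ Ioc (-Real.pi) Real.pi) (hΘm : MeasurableSet Θ)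
    {F : TE3 → ℝ} {w : ℝ → ℝ} (hw : Measurable w)
    (hF : ∀ x : ℝ × ℝ, x.2 ∈ Ioo (-α) α →
      F (normalTorus O ρ b x) = w x.2 / torusJac ρ x) :
    ∫ p in normalTorus O ρ b '' (Θ ×ˢ Icc (-α) α), F p ∂μHE[2] =
      volume.real Θ * ∫ φ in Ioo (-α) α, w φ := by
  set T := normalTorus O ρ b
  have hsub : Θ ×ˢ Ioo (-α) α ⊆ Ioc (-Real.pi) Real.pi ×ˢ Icc (-α) α :=
    prod_mono hΘ Ioo_subset_Icc_self
  have hm : MeasurableSet (Θ ×ˢ Ioo (-α) α) := hΘm.prod measurableSet_Ioo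
  have hTm : MeasurableSet (T '' (Θ ×ˢ Ioo (-α) α)) :=
    hm.image_of_continuousOn_injOn (continuous_normalTorus O ρ b).continuousOn
      ((injOn_normalTorus O hρ b hα).mono hsub)
  have hae : T '' (Θ ×ˢ Icc (-α) α) =ᵐ[μHE[2]] T '' (Θ ×ˢ Ioo (-α) α) := by
    refine (ae_eq_set.2 ⟨?_, ?_⟩)
    · have h0 : ({-α, α} : Set ℝ) ∩ Icc (-α) α ⊆ Icc (-α) α := inter_subset_right
      refine measure_mono_null ?_ (euclideanHausdorffMeasure_normalTorus_of_latitudes O b hρ hα hΘ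
        hΘm h0 ((Set.toFinite _).inter_of_left _))
      rintro _ ⟨⟨⟨s, t⟩, ⟨hs, ht⟩, rfl⟩, hn⟩
      refine ⟨(s, t), ⟨hs, ?_, ht⟩, rfl⟩
      by_contra hne
      simp only [mem_insert_iff, mem_singleton_iff, not_or] at hne
      exact hn ⟨(s, t), ⟨hs, lt_of_le_of_ne ht.1 (Ne.symm hne.1), lt_of_le_of_ne ht.2 hne.2⟩, rfl⟩
    · rw [sdiff_eq_empty.2 (image_mono (prod_mono_right Ioo_subset_Icc_self)), measure_empty]
  -- `F` involves chosen frames and is not known to be measurable. On the open piece it agrees with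
  -- this measurable function, which recovers the latitude as the arcsine of the axial component of
  -- the normal.
  set g : TE3 → ℝ := fun q => w (Real.arcsin (inner ℝ (b 2) q.snd)) /
    √(ρ ^ 2 + Real.cos (Real.arcsin (inner ℝ (b 2) q.snd)) ^ 2) with hg
  have hgm : Measurable g := by
    have h1 : Measurable fun q : TE3 => Real.arcsin (inner ℝ (b 2) q.snd) :=
      Real.measurable_arcsin.comp (measurable_const.inner measurable_snd_TE3)
    exact (hw.comp h1).div ((measurable_const.add
      ((Real.measurable_cos.comp h1).pow_const 2)).sqrt)
  have hgT : ∀ x : ℝ × ℝ, x.2 ∈ Ioo (-α) α → g (T x) = w x.2 / torusJac ρ x := by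
    intro x hx
    simp only [hg, T, normalTorus_snd, inner_spherical_two]
    rw [Real.arcsin_sin (by linarith [hx.1]) (by linarith [hx.2]), torusJac]
  rw [setIntegral_congr_set hae]
  have e1 : ∫ p in T '' (Θ ×ˢ Ioo (-α) α), F p ∂μHE[2] =
      ∫ p in T '' (Θ ×ˢ Ioo (-α) α), g p ∂μHE[2] := by
    refine setIntegral_congr_fun hTm ?_
    rintro _ ⟨x, hx, rfl⟩
    simp only [hF x hx.2, hgT x hx.2]
  rw [e1, setIntegral_normalTorus_image O hρ b hα hsub hm hgm]
  have e2 : ∫ x in Θ ×ˢ Ioo (-α) α, torusJac ρ x * g (T x) =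
      ∫ x in Θ ×ˢ Ioo (-α) α, (fun _ => (1 : ℝ)) x.1 * w x.2 := by
    refine setIntegral_congr_fun hm fun x hx => ?_
    simp only [hgT x hx.2]
    rw [mul_div_cancel₀ _ (torusJac_pos hρ x).ne', one_mul]
  rw [e2, Measure.volume_eq_prod, setIntegral_prod_mul (fun _ => (1 : ℝ)) w]
  simp

variable (hr : 0 < r) (hα0 : 0 < α) (hα : α < Real.pi / 2)
include hr hα0 hα

/-- The circle where the two spheres that bound a lens meet. -/
theorem sphere_inter_sphere_eq_image :
    frontier (Metric.closedBall (O - (r * Real.sin α) • b 2) r) ∩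
      frontier (Metric.closedBall (O + (r * Real.sin α) • b 2) r) =
    (fun θ => O + (r * Real.cos α) • radial b θ) '' Ioc (-Real.pi) Real.pi := by
  rw [frontier_closedBall _ hr.ne', frontier_closedBall _ hr.ne']
  ext y
  constructor
  · rintro ⟨h1, h2⟩
    obtain ⟨θ, hθ, h⟩ := exists_eq_circle b O hr hα0 hα (mem_sphere_iff_norm.1 h1)
      (mem_sphere_iff_norm.1 h2)
    exact ⟨θ, hθ, h.symm⟩
  · rintro ⟨θ, -, rfl⟩
    exact ⟨mem_sphere_iff_norm.2 (norm_circle_sub_left O b hr θ),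
      mem_sphere_iff_norm.2 (norm_circle_sub_right O b hr θ)⟩

theorem normalBundle_lens_inter_eq_image (Θ : Set ℝ) (hΘ : Θ ⊆ Ioc (-Real.pi) Real.pi) :
    normalBundle (lens O b r α) ∩
        {p | p.fst ∈ (fun θ => O + (r * Real.cos α) • radial b θ) '' Θ} =
      normalTorus O (r * Real.cos α) b '' (Θ ×ˢ Icc (-α) α) := by
  have hρ : 0 < r * Real.cos α := mul_pos hr (Real.cos_pos_of_mem_Ioo ⟨by linarith, hα⟩)
  ext q
  constructor
  · rintro ⟨hq, θ, hθ, hqθ⟩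
    have hqθ : O + (r * Real.cos α) • radial b θ = q.fst := hqθ
    obtain ⟨x, hx, rfl⟩ := exists_eq_normalTorus O b hr hα0 hα hq
      (hqθ ▸ norm_circle_sub_left O b hr θ) (hqθ ▸ norm_circle_sub_right O b hr θ)
    have : θ = x.1 := injOn_circle O hρ b (hΘ hθ) hx.1 hqθ
    exact ⟨x, ⟨this ▸ hθ, hx.2⟩, rfl⟩
  · rintro ⟨x, hx, rfl⟩
    exact ⟨normalTorus_mem_normalBundle_lens O b hr hα0 hα hx.2, x.1, hx.1, rfl⟩

variable {Θ : Set ℝ} (hΘ : Θ ⊆ Ioc (-Real.pi) Real.pi) (hΘm : MeasurableSet Θ)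
include hΘ hΘm

theorem measurableSet_circle_image :
    MeasurableSet ((fun θ => O + (r * Real.cos α) • radial b θ) '' Θ) := by
  have hρ : 0 < r * Real.cos α := mul_pos hr (Real.cos_pos_of_mem_Ioo ⟨by linarith, hα⟩)
  have hc := continuous_radial b
  exact hΘm.image_of_continuousOn_injOn (Continuous.continuousOn (by fun_prop))
    ((injOn_circle O hρ b).mono hΘ)

/-- The only normal of this ball at a point of the circle is the end `φ = α` of the arc of normals
of the lens; for the other ball it is `φ = -α`. -/
theorem curvatureMeasure_left_eq_zero (k : ℕ) :
    curvatureMeasure (normalCycle (Metric.closedBall (O - (r * Real.sin α) • b 2) r)) k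
      ((fun θ => O + (r * Real.cos α) • radial b θ) '' Θ) = 0 := by
  have hρ : 0 < r * Real.cos α := mul_pos hr (Real.cos_pos_of_mem_Ioo ⟨by linarith, hα⟩)
  rw [curvatureMeasure_normalCycle _ _ (measurableSet_circle_image O b hr hα0 hα hΘ hΘm)]
  refine setIntegral_measure_zero _ (measure_mono_null ?_
    (euclideanHausdorffMeasure_normalTorus_of_latitudes O b hρ hα hΘ hΘm
      (singleton_subset_iff.2 (right_mem_Icc.2 (by linarith : -α ≤ α))) (finite_singleton α)))
  rintro q ⟨hq, θ, hθ, hqθ⟩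
  exact ⟨(θ, α), ⟨hθ, rfl⟩, (eq_normalTorus_of_smul_snd_left O b hr hqθ.symm
    (smul_snd_eq_of_mem_normalBundle_closedBall hr hq)).symm⟩

theorem curvatureMeasure_right_eq_zero (k : ℕ) :
    curvatureMeasure (normalCycle (Metric.closedBall (O + (r * Real.sin α) • b 2) r)) k
      ((fun θ => O + (r * Real.cos α) • radial b θ) '' Θ) = 0 := by
  have hρ : 0 < r * Real.cos α := mul_pos hr (Real.cos_pos_of_mem_Ioo ⟨by linarith, hα⟩)
  rw [curvatureMeasure_normalCycle _ _ (measurableSet_circle_image O b hr hα0 hα hΘ hΘm)]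
  refine setIntegral_measure_zero _ (measure_mono_null ?_
    (euclideanHausdorffMeasure_normalTorus_of_latitudes O b hρ hα hΘ hΘm
      (singleton_subset_iff.2 (left_mem_Icc.2 (by linarith : -α ≤ α))) (finite_singleton (-α))))
  rintro q ⟨hq, θ, hθ, hqθ⟩
  exact ⟨(θ, -α), ⟨hθ, rfl⟩, (eq_normalTorus_of_smul_snd_right O b hr hqθ.symm
    (smul_snd_eq_of_mem_normalBundle_closedBall hr hq)).symm⟩

variable (hb : 0 < det3 (b 0) (b 1) (b 2))
include hb

theorem curvatureMeasure_lens_one :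
    curvatureMeasure (normalCycle (lens O b r α)) 1
      ((fun θ => O + (r * Real.cos α) • radial b θ) '' Θ) =
      volume.real Θ * (2 * α * (r * Real.cos α)) := by
  have hρ : 0 < r * Real.cos α := mul_pos hr (Real.cos_pos_of_mem_Ioo ⟨by linarith, hα⟩)
  rw [curvatureMeasure_normalCycle _ _ (measurableSet_circle_image O b hr hα0 hα hΘ hΘm),
    normalBundle_lens_inter_eq_image O b hr hα0 hα Θ hΘ,
    setIntegral_normalTorus_image_of_eq O b hρ hα hΘ hΘm
      (w := fun _ => r * Real.cos α) measurable_const fun x hx =>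
        (invariantForm_positiveTangentFrame hρ b x hb
          (Real.cos_pos_of_mem_Ioo ⟨by linarith [hx.1], by linarith [hx.2]⟩)
          (tangentConeAt_normalBundle_lens O b hr hα0 hα hx)).1]
  rw [setIntegral_const, smul_eq_mul, Real.volume_real_Ioo_of_le (by linarith)]
  ring

theorem curvatureMeasure_lens_two :
    curvatureMeasure (normalCycle (lens O b r α)) 2
      ((fun θ => O + (r * Real.cos α) • radial b θ) '' Θ) =
      volume.real Θ * (2 * Real.sin α) := by
  have hρ : 0 < r * Real.cos α := mul_pos hr (Real.cos_pos_of_mem_Ioo ⟨by linarith, hα⟩)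
  rw [curvatureMeasure_normalCycle _ _ (measurableSet_circle_image O b hr hα0 hα hΘ hΘm),
    normalBundle_lens_inter_eq_image O b hr hα0 hα Θ hΘ,
    setIntegral_normalTorus_image_of_eq O b hρ hα hΘ hΘm
      (w := Real.cos) Real.measurable_cos fun x hx =>
        (invariantForm_positiveTangentFrame hρ b x hb
          (Real.cos_pos_of_mem_Ioo ⟨by linarith [hx.1], by linarith [hx.2]⟩)
          (tangentConeAt_normalBundle_lens O b hr hα0 hα hx)).2]
  rw [← integral_Ioc_eq_integral_Ioo, ← intervalIntegral.integral_of_le (by linarith),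
    integral_cos, Real.sin_neg]
  ring

end

/-! ### The curvature measures of the union of two balls -/

theorem exists_direct_orthonormalBasis {u : E3} (hu : ‖u‖ = 1) :
    ∃ b : OrthonormalBasis (Fin 3) ℝ E3, b 2 = u ∧ 0 < det3 (b 0) (b 1) (b 2) := by
  obtain ⟨b, hb⟩ := Orthonormal.exists_orthonormalBasis_extension_of_card_eq (𝕜 := ℝ) (E := E3)
    (ι := Fin 3) (by simp) (v := fun _ => u) (s := {2}) (by
      rw [orthonormal_iff_ite]
      rintro ⟨i, hi⟩ ⟨j, hj⟩
      rw [mem_singleton_iff] at hi hj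
      subst hi hj
      simp [hu])
  have hb2 : b 2 = u := hb 2 rfl
  -- Otherwise `det3` would vanish identically, but it is `1` on the standard basis. If it is
  -- negative, swapping `b 0` and `b 1` corrects the sign and keeps `b 2`.
  have hne : det3 (b 0) (b 1) (b 2) ≠ 0 := by
    intro h0
    have h1 := det3_eq_coords b (EuclideanSpace.single 0 1) (EuclideanSpace.single 1 1)
      (EuclideanSpace.single 2 1)
    rw [h0, zero_mul] at h1
    simp [det3, Matrix.det_fin_three] at h1
  rcases lt_or_gt_of_ne hne with h | h
  · have h2 : Equiv.swap (0 : Fin 3) 1 2 = 2 := by decide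
    refine ⟨b.reindex (Equiv.swap 0 1), ?_, ?_⟩
    · simpa [h2] using hb2
    · have hs : det3 (b 1) (b 0) (b 2) = -det3 (b 0) (b 1) (b 2) := by
        have := det3_smul_add_smul (b 0) (b 1) (b 2) 0 1 1 0
        simpa using this
      have e : det3 (b.reindex (Equiv.swap 0 1) 0) (b.reindex (Equiv.swap 0 1) 1)
          (b.reindex (Equiv.swap 0 1) 2) = det3 (b 1) (b 0) (b 2) := by
        simp [h2]
      rw [e, hs]
      linarith
  · exact ⟨b, hb2, h⟩

theorem mainTheorem7 (A₁ A₂ : E3) (r : ℝ) (hr : 0 < r) (hne : A₁ ≠ A₂)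
    (hint : dist A₁ A₂ < 2 * r) (C : Set E3)
    (hC : C = frontier (Metric.closedBall A₁ r) ∩ frontier (Metric.closedBall A₂ r))
    (B : Set E3) (hB : MeasurableSet B) (β : ℝ)
    (hβ : β = 2 * Real.pi * ((μHE[1] (B ∩ C)).toReal / (μHE[1] C).toReal)) :
    meanCurvatureMeasure ![Metric.closedBall A₁ r, Metric.closedBall A₂ r] (B ∩ C) =
        -2 * β * r * Real.arcsin (dist A₁ A₂ / (2 * r)) *
          √(1 - (dist A₁ A₂ / (2 * r)) ^ 2) ∧
      gaussCurvatureMeasure ![Metric.closedBall A₁ r, Metric.closedBall A₂ r] (B ∩ C) =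
        -(β * dist A₁ A₂ / r) := by
  have hd : 0 < dist A₁ A₂ := dist_pos.2 hne
  set d := dist A₁ A₂ with hd_def
  have hnorm : ‖A₂ - A₁‖ = d := by rw [hd_def, dist_comm, dist_eq_norm]
  obtain ⟨b, hb2, hb⟩ := exists_direct_orthonormalBasis (u := d⁻¹ • (A₂ - A₁)) (by
    rw [norm_smul, hnorm, norm_inv, Real.norm_eq_abs, abs_of_pos hd, inv_mul_cancel₀ hd.ne'])
  -- The angle between the plane of the circle and a radius ending on it: the centre is at distance
  -- `d / 2` from that plane.
  set α := Real.arcsin (d / (2 * r)) with hα_def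
  have hq0 : 0 < d / (2 * r) := by positivity
  have hq1 : d / (2 * r) < 1 := (div_lt_one (by positivity)).2 hint
  have hα0 : 0 < α := Real.arcsin_pos.2 hq0
  have hα : α < Real.pi / 2 := Real.arcsin_lt_pi_div_two.2 hq1
  have hsin : Real.sin α = d / (2 * r) := Real.sin_arcsin (by linarith) hq1.le
  have hcos : Real.cos α = √(1 - (d / (2 * r)) ^ 2) := Real.cos_arcsin _
  have hrs : r * Real.sin α = d / 2 := by
    rw [hsin]
    field_simp
  set O := A₁ + (d / 2) • b 2 with hO
  have hA₁ : A₁ = O - (r * Real.sin α) • b 2 := by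
    rw [hrs, hO, add_sub_cancel_right]
  have hA₂ : A₂ = O + (r * Real.sin α) • b 2 := by
    rw [hrs, hO, add_assoc, ← add_smul, add_halves, hb2, smul_smul, mul_inv_cancel₀ hd.ne',
      one_smul, add_sub_cancel]
  have hρ : 0 < r * Real.cos α := mul_pos hr (Real.cos_pos_of_mem_Ioo ⟨by linarith, hα⟩)
  set c : ℝ → E3 := fun θ => O + (r * Real.cos α) • radial b θ with hc_def
  have hc : Continuous c := by
    have := continuous_radial b
    fun_prop
  have hCc : C = c '' Ioc (-Real.pi) Real.pi := by
    rw [hC, hA₁, hA₂]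
    exact sphere_inter_sphere_eq_image O b hr hα0 hα
  set Θ : Set ℝ := c ⁻¹' B ∩ Ioc (-Real.pi) Real.pi with hΘ_def
  have hΘ : Θ ⊆ Ioc (-Real.pi) Real.pi := inter_subset_right
  have hΘm : MeasurableSet Θ := (hc.measurable hB).inter measurableSet_Ioc
  have hBC : B ∩ C = c '' Θ := by
    rw [hCc, hΘ_def, image_preimage_inter]
  -- Both lengths carry the factor `ρ`, and the full circle has `2π` of longitude.
  have hβ' : β = volume.real Θ := by
    rw [hβ, hBC, hCc, euclideanHausdorffMeasure_circle O hρ b hΘ hΘm,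
      euclideanHausdorffMeasure_circle O hρ b subset_rfl measurableSet_Ioc, Real.volume_Ioc,
      ENNReal.toReal_mul, ENNReal.toReal_mul, ENNReal.toReal_ofReal hρ.le,
      ENNReal.toReal_ofReal (by linarith [Real.pi_pos]), mul_div_mul_left _ _ hρ.ne',
      Measure.real]
    have := Real.pi_pos
    field_simp
    ring
  have hlens : Metric.closedBall (O - (r * Real.sin α) • b 2) r ∩
      Metric.closedBall (O + (r * Real.sin α) • b 2) r = lens O b r α := rfl
  rw [meanCurvatureMeasure, gaussCurvatureMeasure, curvatureMeasure_unionNormalCycle_pair,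
    curvatureMeasure_unionNormalCycle_pair, hBC, hA₁, hA₂, hlens,
    curvatureMeasure_left_eq_zero O b hr hα0 hα hΘ hΘm,
    curvatureMeasure_left_eq_zero O b hr hα0 hα hΘ hΘm,
    curvatureMeasure_right_eq_zero O b hr hα0 hα hΘ hΘm,
    curvatureMeasure_right_eq_zero O b hr hα0 hα hΘ hΘm,
    curvatureMeasure_lens_one O b hr hα0 hα hΘ hΘm hb,
    curvatureMeasure_lens_two O b hr hα0 hα hΘ hΘm hb, ← hcos, ← hβ', hsin]
  constructor
  · ring
  · field_simp
    ring
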